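/- For words $u,v$ over a finite alphabet $\Sigma$ let $\binom{u}{v}$ be the number of occurrences of $v$ as a scattered factor of $u$, that is, the number of sequences $i_1<\dots<i_{|v|}$ of positions of $u$ with $u[i_1]\cdots u[i_{|v|}]=v$. Words $u,u'\in\Sigma^*$ are $k$-binomial equivalent, $u\equiv_k u'$, if $\binom{u}{y}=\binom{u'}{y}$ for all words $y\in\Sigma^*$ of length at most $k$. Theorem. There is a deterministic algorithm which, given two words $w$ and $x$ over a finite alphabet and a number $k\in\mathbb{N}$, finds all the factors of $w$ that are $k$-binomial equivalent to $x$ in polynomial time. Precisely: it outputs, without repetition, exactly the pairs $(i,\ell)$ with $i,\ell\ge 0$ and $i+\ell\le |w|$ such that $w[i+1..i+\ell]\equiv_k x$. The time is measured on the unit-cost RAM with logarithmic word size: for an input of size $N$ (one memory cell for each letter of $w$ and $x$ and for each binary digit of $k$, and one cell for the length of each of the three parts) the machine words have $W\ge C\log_2 N$ bits for a suitable constant $C>0$, the letters of the alphabet are given as distinct machine words, and every arithmetic (addition, subtraction, multiplication, division, remainder, shift, bitwise, comparison), data movement (including indirect addressing) and control instruction costs one step. The program, the constant $C$ and the polynomial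 in $N$ that bounds the number of steps depend neither on the alphabet nor on $w$, $x$, $k$, $W$. -/

import Mathlib

/-! ### Binomial coefficients of words and `k`-binomial equivalence -/

/-- The binomial coefficient of the words `u` and `v`: the number of occurrences of `v` as a
scattered factor of `u`. (`List.sublists u` has one entry for each set of positions of `u`, namely
the word read off at these positions in increasing order, so `v` is counted with multiplicity.) -/
def wordBinom {A : Type} [DecidableEq A] (u v : List A) : ℕ :=
  u.sublists.count v

/-- `u` and `v` are `k`-binomial equivalent. -/
def BinomEquiv {A : Type} [DecidableEq A] (k : ℕ) (u v : List A) : Prop :=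
  ∀ y : List A, y.length ≤ k → wordBinom u y = wordBinom v y

/-- The pair `(i, l)` is an occurrence in `w` of a factor that is `k`-binomial equivalent to `x`:
the factor of `w` of length `l` that follows the first `i` letters lies inside `w` and is
equivalent to `x`. -/
def IsBinomMatch {A : Type} [DecidableEq A] (w x : List A) (k : ℕ) (q : ℕ × ℕ) : Prop :=
  q.1 + q.2 ≤ w.length ∧ BinomEquiv k ((w.drop q.1).take q.2) x

/-! ### The unit-cost RAM with bounded machine words -/

namespace WordRAM

/-- Binary operations of the machine. -/
inductive BinOp where
  | add | sub | mul | div | rem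
  | band | bor | bxor | shl | shr
  | eq | lt

/-- Value of a binary operation on machine words of `W` bits, before truncation to `W` bits.
Subtraction is modulo `2 ^ W`; the comparisons return `0` or `1`. -/
def BinOp.eval (W : ℕ) : BinOp → ℕ → ℕ → ℕ
  | add, a, b => a + b
  | sub, a, b => a + (2 ^ W - b % 2 ^ W)
  | mul, a, b => a * b
  | div, a, b => a / b
  | rem, a, b => a % b
  | band, a, b => a &&& b
  | bor, a, b => a ||| b
  | bxor, a, b => a ^^^ b
  | shl, a, b => a * 2 ^ b
  | shr, a, b => a / 2 ^ b
  | eq, a, b => if a = b then 1 else 0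
  | lt, a, b => if a < b then 1 else 0

/-- Instructions. The numbers `d`, `a`, `b` name registers, `l` is a position in the program. -/
inductive Instr where
  /-- `r_d := c` -/
  | const (d c : ℕ)
  /-- `r_d := r_a` -/
  | copy (d a : ℕ)
  /-- `r_d := r_a o r_b` -/
  | op (o : BinOp) (d a b : ℕ)
  /-- `r_d := mem[r_a]` -/
  | load (d a : ℕ)
  /-- `mem[r_a] := r_b` -/
  | store (a b : ℕ)
  /-- unconditional branch -/
  | jump (l : ℕ)
  /-- branch if `r_a = 0` -/
  | jumpZero (a l : ℕ)
  /-- subroutine call: the return position is kept in `r_d` -/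
  | call (d l : ℕ)
  /-- return from a subroutine to the position kept in `r_a` -/
  | ret (a : ℕ)

/-- A program is a finite list of instructions; it mentions only finitely many registers. -/
abbrev Program := List Instr

/-- A configuration: program counter, registers, memory. -/
structure Config where
  pc : ℕ
  reg : ℕ → ℕ
  mem : ℕ → ℕ

/-- Write the `W` low-order bits of `v` into the register `d`, and go to the next instruction. -/
def Config.setReg (W : ℕ) (c : Config) (d v : ℕ) : Config :=
  { pc := c.pc + 1, reg := Function.update c.reg d (v % 2 ^ W), mem := c.mem }

/-- Execution of one instruction on a machine with words of `W` bits. -/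
def Instr.exec (W : ℕ) (c : Config) : Instr → Config
  | const d v => c.setReg W d v
  | copy d a => c.setReg W d (c.reg a)
  | op o d a b => c.setReg W d (o.eval W (c.reg a) (c.reg b))
  | load d a => c.setReg W d (c.mem (c.reg a))
  | store a b =>
      { pc := c.pc + 1, reg := c.reg, mem := Function.update c.mem (c.reg a) (c.reg b) }
  | jump l => { c with pc := l }
  | jumpZero a l => { c with pc := if c.reg a = 0 then l else c.pc + 1 }
  | call d l => { c.setReg W d (c.pc + 1) with pc := l }
  | ret a => { c with pc := c.reg a }

/-- The machine has halted when the program counter has left the program. -/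
def Halted (P : Program) (c : Config) : Prop := P.length ≤ c.pc

/-- One step: execute the current instruction; a halted machine does not move. -/
def step (W : ℕ) (P : Program) (c : Config) : Config :=
  match P[c.pc]? with
  | some I => I.exec W c
  | none => c

/-- Initial configuration: the input occupies the first memory cells, all else is zero. -/
def init (input : List ℕ) : Config :=
  { pc := 0, reg := fun _ => 0, mem := fun i => input.getD i 0 }

/-- The list `out` is the output of the configuration `c`: it stands in consecutive memory cells,
from the address in register `0` on, and its length is in register `1`. -/
def Outputs (W : ℕ) (c : Config) (out : List ℕ) : Prop :=
  c.reg 1 = out.length ∧ c.reg 0 + out.length ≤ 2 ^ W ∧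
    ∀ (i : ℕ) (h : i < out.length), c.mem (c.reg 0 + i) = out[i]

/-- With words of `W` bits, the program `P` halts on `input` after at most `T` instructions, with
output `out`. -/
def ComputesWithin (W : ℕ) (P : Program) (input : List ℕ) (T : ℕ) (out : List ℕ) : Prop :=
  ∃ t ≤ T, Halted P ((step W P)^[t] (init input)) ∧ Outputs W ((step W P)^[t] (init input)) out

end WordRAM

/-! ### Input and output format of the matching problem -/

/-- The input `(w, x, k)`, laid out in memory cells: each of the three parts is preceded by its
length, a letter `a` takes the one cell `code a`, and `k` is written in binary, one bit per cell,
least significant bit first. -/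
def matchInput {A : Type} (code : A → ℕ) (w x : List A) (k : ℕ) : List ℕ :=
  (w.length :: w.map code) ++ (x.length :: x.map code) ++
    ((Nat.digits 2 k).length :: Nat.digits 2 k)

/-- A list of pairs, laid out in memory cells. -/
def pairsOutput (L : List (ℕ × ℕ)) : List ℕ :=
  L.flatMap fun q => [q.1, q.2]

/-!
The words `u` and `v` are `k`-binomial equivalent if and only if, for each `j ≤ k`, the sum over all
words `y` of length `j` of `(wordBinom u y - wordBinom v y) ^ 2` vanishes. Expanding the square,
this is the identity `⟨u, u⟩ + ⟨v, v⟩ = 2 ⟨u, v⟩` for the number `⟨u, v⟩` of pairs of occurrences of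
a common scattered factor of length `j`. Inclusion-exclusion on the last letters yields a recurrence
for `⟨u, v⟩` in terms of prefixes, so a table of polynomial size contains all that is needed, and
`k` may be replaced by a bound on the length of the words. The entries are exponentially large, but
the least common multiple of `1, …, n` is at least `2 ^ n / (n + 1)`, so two such numbers are equal
once they agree modulo all `m` up to a linear bound, and all arithmetic can be done modulo small
numbers.
-/

/-! ### Comparison of numbers by their small residues -/

theorem eq_of_forall_modEq {n a b : ℕ} (ha : a ≤ 2 ^ n) (hb : b ≤ 2 ^ n)
    (h : ∀ m, 0 < m → m ≤ 2 * n + 2 → a ≡ b [MOD m]) : a = b := by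
  by_contra hne
  have hdvd : Nat.lcmUpto (2 * n + 2) ∣ ((b : ℤ) - a).natAbs := by
    refine Finset.lcm_dvd fun m hm => ?_
    obtain ⟨hm0, hmn⟩ := Finset.mem_Icc.1 hm
    exact Int.natCast_dvd.1 (Nat.modEq_iff_dvd.1 (h m hm0 hmn))
  have hle : Nat.lcmUpto (2 * n + 2) ≤ 2 ^ n :=
    (Nat.le_of_dvd (by omega) hdvd).trans (by omega)
  have hpow : 2 * n + 3 < 2 ^ (n + 2) := by
    have := Nat.lt_pow_self (n := n + 1) one_lt_two
    rw [pow_succ]; omega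
  refine absurd (Chebyshev.two_pow_le_mul_lcmUpto (2 * n + 2)) (not_le.2 ?_)
  calc (2 * n + 2 + 1) * Nat.lcmUpto (2 * n + 2) ≤ (2 * n + 3) * 2 ^ n :=
        Nat.mul_le_mul_left _ hle
    _ < 2 ^ (n + 2) * 2 ^ n := Nat.mul_lt_mul_of_pos_right hpow (by positivity)
    _ = 2 ^ (2 * n + 2) := by rw [← pow_add]; congr 1; ring

/-! ### The kernel of scattered factors of a given length -/

section WordBinom

variable {A : Type} [DecidableEq A]

theorem wordBinom_nil_right (u : List A) : wordBinom u [] = 1 := by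
  induction u using List.reverseRecOn with
  | nil => simp [wordBinom]
  | append_singleton u b ih =>
    rw [wordBinom, List.sublists_concat, List.count_append,
      List.count_eq_zero_of_not_mem (l := List.map _ _) (by simp)]
    exact ih

theorem wordBinom_concat_concat (u y : List A) (b a : A) :
    wordBinom (u ++ [b]) (y ++ [a]) =
      wordBinom u (y ++ [a]) + if a = b then wordBinom u y else 0 := by
  rw [wordBinom, List.sublists_concat, List.count_append]
  congr 1
  split_ifs with h
  · subst h
    exact List.count_map_of_injective _ (fun x => x ++ [a]) (List.append_left_injective [a]) y
  · refine List.count_eq_zero_of_not_mem fun hm => ?_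
    obtain ⟨z, -, hz⟩ := List.mem_map.1 hm
    exact h (by simpa using (List.append_inj_right' hz rfl).symm)

theorem wordBinom_eq_zero_of_length_lt {u y : List A} (h : u.length < y.length) :
    wordBinom u y = 0 :=
  List.count_eq_zero_of_not_mem fun hm => h.not_ge (List.mem_sublists.1 hm).length_le

theorem wordBinom_le (u y : List A) : wordBinom u y ≤ 2 ^ u.length :=
  List.count_le_length.trans_eq (List.length_sublists u)

theorem wordBinom_map {B : Type} [DecidableEq B] {f : A → B} (hf : Function.Injective f)
    (u y : List A) : wordBinom (u.map f) (y.map f) = wordBinom u y := by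
  rw [wordBinom, List.sublists_map]
  exact List.count_map_of_injective _ _ hf.list_map y

theorem binomEquiv_map {B : Type} [DecidableEq B] {f : A → B} (hf : Function.Injective f) (k : ℕ)
    (u x : List A) : BinomEquiv k (u.map f) (x.map f) ↔ BinomEquiv k u x := by
  refine ⟨fun h y hy => ?_, fun h y hy => ?_⟩
  · rw [← wordBinom_map hf, ← wordBinom_map hf]
    exact h _ (by simpa using hy)
  · by_cases hm : ∃ z : List A, z.map f = y
    · obtain ⟨z, rfl⟩ := hm
      rw [wordBinom_map hf, wordBinom_map hf]
      exact h _ (by simpa using hy)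
    · have h0 : ∀ v : List A, wordBinom (v.map f) y = 0 := fun v => by
        refine List.count_eq_zero_of_not_mem fun hv => hm ?_
        rw [List.sublists_map, List.mem_map] at hv
        exact ⟨_, hv.choose_spec.2⟩
      rw [h0, h0]

theorem isBinomMatch_map {B : Type} [DecidableEq B] {f : A → B} (hf : Function.Injective f)
    (w x : List A) (k : ℕ) (q : ℕ × ℕ) :
    IsBinomMatch (w.map f) (x.map f) k q ↔ IsBinomMatch w x k q := by
  rw [IsBinomMatch, IsBinomMatch, List.length_map, ← List.map_drop, ← List.map_take,
    binomEquiv_map hf]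

theorem binomEquiv_min {u x : List A} {N : ℕ} (hu : u.length ≤ N) (hx : x.length ≤ N) (k : ℕ) :
    BinomEquiv (min k N) u x ↔ BinomEquiv k u x := by
  refine ⟨fun h y hy => ?_, fun h y hy => h y (hy.trans (min_le_left _ _))⟩
  by_cases hN : y.length ≤ N
  · exact h y (le_min hy hN)
  · rw [wordBinom_eq_zero_of_length_lt (by omega), wordBinom_eq_zero_of_length_lt (by omega)]

/-- The inner product of `u` and `v` as vectors of the numbers of occurrences of all words of
length `j`, that is, the number of pairs of occurrences in `u` and in `v` of a common scattered
factor of length `j`. It reduces the comparison of exponentially many binomial coefficients to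
the comparison of three numbers. -/
def binomKernel (j : ℕ) (u v : List A) : ℕ :=
  ((u.sublists.filter fun y => y.length = j).map (wordBinom v)).sum

theorem binomKernel_zero (u v : List A) : binomKernel 0 u v = 1 := by
  have h : (u.sublists.filter fun y => y.length = 0) = u.sublists.filter (· == []) :=
    List.filter_congr fun y _ => by cases y <;> simp
  rw [binomKernel, h, List.filter_beq, List.map_replicate, List.sum_replicate,
    wordBinom_nil_right]
  exact (mul_one _).trans (wordBinom_nil_right u)

theorem binomKernel_nil_left (j : ℕ) (v : List A) : binomKernel (j + 1) [] v = 0 := by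
  simp [binomKernel]

theorem binomKernel_nil_right (j : ℕ) (u : List A) : binomKernel (j + 1) u [] = 0 := by
  refine List.sum_eq_zero fun n hn => ?_
  obtain ⟨y, hy, rfl⟩ := List.mem_map.1 hn
  have hlen : y.length = j + 1 := by simpa using (List.mem_filter.1 hy).2
  exact wordBinom_eq_zero_of_length_lt (by simp [hlen])

theorem binomKernel_concat_left (j : ℕ) (u v : List A) (a : A) :
    binomKernel (j + 1) (u ++ [a]) v = binomKernel (j + 1) u v +
      ((u.sublists.filter fun y => y.length = j).map fun y => wordBinom v (y ++ [a])).sum := by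
  simp [binomKernel, List.sublists_concat, List.filter_map, Function.comp_def]

theorem binomKernel_concat_concat (j : ℕ) (u v : List A) (a b : A) :
    binomKernel (j + 1) (u ++ [a]) (v ++ [b]) + binomKernel (j + 1) u v =
      binomKernel (j + 1) (u ++ [a]) v + binomKernel (j + 1) u (v ++ [b]) +
        if a = b then binomKernel j u v else 0 := by
  have hsum : ((u.sublists.filter fun y => y.length = j).map fun y =>
        wordBinom (v ++ [b]) (y ++ [a])).sum =
      ((u.sublists.filter fun y => y.length = j).map fun y => wordBinom v (y ++ [a])).sum +
        if a = b then binomKernel j u v else 0 := by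
    split_ifs with h <;> simp [wordBinom_concat_concat, h, List.sum_map_add, binomKernel]
  rw [binomKernel_concat_left, binomKernel_concat_left, hsum]
  ring

theorem binomKernel_eq_sum {j : ℕ} (u v : List A) {F : Finset (List A)}
    (hF : ∀ y ∈ F, y.length = j) (huF : ∀ y, y.Sublist u → y.length = j → y ∈ F) :
    binomKernel j u v = ∑ y ∈ F, wordBinom u y * wordBinom v y := by
  set l := u.sublists.filter fun y => y.length = j
  have hlist : binomKernel j u v = ∑ y ∈ l.toFinset, l.count y * wordBinom v y := by
    refine (Finset.sum_list_map_count l (wordBinom v)).trans (Finset.sum_congr rfl fun y _ => ?_)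
    rw [smul_eq_mul]
    congr!
  have hsub : l.toFinset ⊆ F := fun y hy => by
    simp only [l, List.mem_toFinset, List.mem_filter, List.mem_sublists, decide_eq_true_eq] at hy
    exact huF y hy.1 hy.2
  rw [hlist]
  refine (Finset.sum_subset hsub fun y _ hy => ?_).trans (Finset.sum_congr rfl fun y hy => ?_)
  · rw [List.count_eq_zero_of_not_mem (by simpa using hy), zero_mul]
  · exact congrArg (· * _) (List.count_filter (by simpa using hF y hy))

theorem binomKernel_self_add_self_eq_iff (j : ℕ) (u v : List A) :
    binomKernel j u u + binomKernel j v v = 2 * binomKernel j u v ↔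
      ∀ y : List A, y.length = j → wordBinom u y = wordBinom v y := by
  classical
  set F := ((u.sublists ++ v.sublists).filter fun y => y.length = j).toFinset
  have hmem : ∀ y, y ∈ F ↔ (y.Sublist u ∨ y.Sublist v) ∧ y.length = j := fun y => by
    simp [F, or_and_right]
  have hF : ∀ y ∈ F, y.length = j := fun y hy => ((hmem y).1 hy).2
  have huF : ∀ y, y.Sublist u → y.length = j → y ∈ F := fun y hy hj => (hmem y).2 ⟨.inl hy, hj⟩
  have hvF : ∀ y, y.Sublist v → y.length = j → y ∈ F := fun y hy hj => (hmem y).2 ⟨.inr hy, hj⟩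
  have hzero : ∀ (s : List A) (y : List A), ¬ y.Sublist s → wordBinom s y = 0 := fun s y h =>
    List.count_eq_zero_of_not_mem fun hm => h (List.mem_sublists.1 hm)
  have hsq : (binomKernel j u u + binomKernel j v v - 2 * binomKernel j u v : ℤ) =
      ∑ y ∈ F, ((wordBinom u y : ℤ) - wordBinom v y) ^ 2 := by
    rw [binomKernel_eq_sum u u hF huF, binomKernel_eq_sum v v hF hvF,
      binomKernel_eq_sum u v hF huF]
    push_cast
    rw [Finset.mul_sum, ← Finset.sum_add_distrib, ← Finset.sum_sub_distrib]
    exact Finset.sum_congr rfl fun y _ => by ring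
  have hiff : binomKernel j u u + binomKernel j v v = 2 * binomKernel j u v ↔
      ∑ y ∈ F, ((wordBinom u y : ℤ) - wordBinom v y) ^ 2 = 0 := by
    rw [← hsq]; omega
  rw [hiff, Finset.sum_eq_zero_iff_of_nonneg fun y _ => sq_nonneg _]
  refine ⟨fun h y hy => ?_, fun h y hy => by rw [h y (hF y hy), sub_self, zero_pow two_ne_zero]⟩
  by_cases hyF : y ∈ F
  · have := h y hyF
    rw [sq_eq_zero_iff, sub_eq_zero] at this
    exact_mod_cast this
  · rw [hzero u y fun hs => hyF (huF y hs hy), hzero v y fun hs => hyF (hvF y hs hy)]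

theorem binomEquiv_iff_binomKernel {k : ℕ} {u v : List A} :
    BinomEquiv k u v ↔
      ∀ j ≤ k, binomKernel j u u + binomKernel j v v = 2 * binomKernel j u v := by
  simp only [binomKernel_self_add_self_eq_iff]
  exact ⟨fun h j hj y hy => h y (hy.trans_le hj), fun h y hy => h _ hy y rfl⟩

theorem binomKernel_le (j : ℕ) (u v : List A) :
    binomKernel j u v ≤ 2 ^ (u.length + v.length) := by
  refine (List.sum_le_card_nsmul _ (2 ^ v.length) fun n hn => ?_).trans ?_
  · obtain ⟨y, -, rfl⟩ := List.mem_map.1 hn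
    exact wordBinom_le v y
  · rw [List.length_map, smul_eq_mul, pow_add]
    exact Nat.mul_le_mul_right _ ((List.length_filter_le _ _).trans_eq (List.length_sublists u))

theorem binomEquiv_iff_forall_modEq {u v : List A} {N : ℕ} (hu : u.length < N) (hv : v.length < N)
    (k : ℕ) :
    BinomEquiv k u v ↔ ∀ j ≤ min k (N - 1), ∀ m, 0 < m → m ≤ 4 * N →
      binomKernel j u u + binomKernel j v v ≡ 2 * binomKernel j u v [MOD m] := by
  rw [← binomEquiv_min (Nat.le_sub_one_of_lt hu) (Nat.le_sub_one_of_lt hv) k,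
    binomEquiv_iff_binomKernel]
  refine forall₂_congr fun j _ => ⟨fun h m _ _ => h ▸ Nat.ModEq.rfl, fun h =>
    eq_of_forall_modEq (n := 2 * N - 1) ?_ ?_ fun m hm hmN => h m hm (by omega)⟩
  · calc binomKernel j u u + binomKernel j v v
        ≤ 2 ^ (2 * N - 2) + 2 ^ (2 * N - 2) := Nat.add_le_add
          ((binomKernel_le j u u).trans (Nat.pow_le_pow_right two_pos (by omega)))
          ((binomKernel_le j v v).trans (Nat.pow_le_pow_right two_pos (by omega)))
      _ = 2 ^ (2 * N - 1) := by rw [← two_mul, ← pow_succ']; congr 1; omega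
  · calc 2 * binomKernel j u v ≤ 2 * 2 ^ (2 * N - 2) := Nat.mul_le_mul_left 2
          ((binomKernel_le j u v).trans (Nat.pow_le_pow_right two_pos (by omega)))
      _ = 2 ^ (2 * N - 1) := by rw [← pow_succ']; congr 1; omega

end WordBinom

/-! ### A structured language and its compilation -/

namespace WordRAM

/-- A state of the structured language: the values of the variables, and the memory. -/
structure St (V : Type) where
  var : V → ℕ
  mem : ℕ → ℕ

/-- The value of a binary operation on natural numbers; subtraction is truncated at `0`. -/
def BinOp.natEval : BinOp → ℕ → ℕ → ℕ
  | .sub, a, b => a - b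
  | o, a, b => o.eval 0 a b

/-- A condition under which a binary operation on numbers below `M` has a value below `M` that
is the same on the machine and on natural numbers. It holds for no bit operation, as
programs of the structured language do not use them. -/
def BinOp.Safe (M : ℕ) : BinOp → ℕ → ℕ → Prop
  | .add, a, b => a + b < M
  | .sub, a, b => b ≤ a
  | .mul, a, b => a * b < M
  | .div, _, _ => True
  | .rem, _, _ => True
  | .eq, _, _ => True
  | .lt, _, _ => True
  | _, _, _ => False

theorem BinOp.Safe.eval_mod {W : ℕ} (hW : 0 < W) {o : BinOp} {a b : ℕ} (ha : a < 2 ^ W)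
    (hb : b < 2 ^ W) (h : o.Safe (2 ^ W) a b) :
    o.natEval a b < 2 ^ W ∧ o.eval W a b % 2 ^ W = o.natEval a b := by
  have h1 : 1 < 2 ^ W := Nat.one_lt_two_pow hW.ne'
  cases o <;> simp only [BinOp.Safe] at h <;> simp only [BinOp.natEval, BinOp.eval]
  case add => exact ⟨h, Nat.mod_eq_of_lt h⟩
  case sub =>
    refine ⟨by omega, ?_⟩
    rw [Nat.mod_eq_of_lt hb, show a + (2 ^ W - b) = (a - b) + 2 ^ W by omega, Nat.add_mod_right,
      Nat.mod_eq_of_lt (by omega)]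
  case mul => exact ⟨h, Nat.mod_eq_of_lt h⟩
  case div =>
    have := (Nat.div_le_self a b).trans_lt ha
    exact ⟨this, Nat.mod_eq_of_lt this⟩
  case rem =>
    have := (Nat.mod_le a b).trans_lt ha
    exact ⟨this, Nat.mod_eq_of_lt this⟩
  case eq =>
    have : (if a = b then 1 else 0) < 2 ^ W := by split <;> omega
    exact ⟨this, Nat.mod_eq_of_lt this⟩
  case lt =>
    have : (if a < b then 1 else 0) < 2 ^ W := by split <;> omega
    exact ⟨this, Nat.mod_eq_of_lt this⟩

/-- Expressions of the structured language, over variables of type `V`. -/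
inductive Ex (V : Type) where
  | lit (n : ℕ)
  | var (x : V)
  | op (o : BinOp) (a b : Ex V)
  | load (a : Ex V)

/-- Commands of the structured language. The command `loop x y b` executes `b` for
`x = 0, 1, …` below the value of `y`. -/
inductive Cmd (V : Type) where
  | skip
  | assign (x : V) (e : Ex V)
  | store (a e : Ex V)
  | seq (s t : Cmd V)
  | ite (e : Ex V) (s t : Cmd V)
  | loop (x y : V) (b : Cmd V)

/-- The variables that a command assigns to. -/
def Cmd.writes {V : Type} : Cmd V → List V
  | skip => []
  | assign x _ => [x]
  | store _ _ => []
  | seq s t => s.writes ++ t.writes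
  | ite _ s t => s.writes ++ t.writes
  | loop x _ b => x :: b.writes

section Semantics

variable {V : Type}

/-- The value of an expression in unbounded arithmetic. -/
def Ex.eval (σ : St V) : Ex V → ℕ
  | lit n => n
  | var x => σ.var x
  | op o a b => o.natEval (a.eval σ) (b.eval σ)
  | load a => σ.mem (a.eval σ)

/-- All values in the evaluation of an expression stay below the bound `M`, provided that the
values in the state `σ` are below `M`. -/
def Ex.Ok (M : ℕ) (σ : St V) : Ex V → Prop
  | lit n => n < M
  | var _ => True
  | op o a b => a.Ok M σ ∧ b.Ok M σ ∧ o.Safe M (a.eval σ) (b.eval σ)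
  | load a => a.Ok M σ

/-- Write `v` into the memory cell `a`. -/
def St.write (σ : St V) (a v : ℕ) : St V :=
  { σ with mem := Function.update σ.mem a v }

@[simp] theorem St.var_write (σ : St V) (a v : ℕ) : (σ.write a v).var = σ.var := rfl

theorem St.mem_write (σ : St V) (a v b : ℕ) :
    (σ.write a v).mem b = if b = a then v else σ.mem b := by
  simp [St.write, Function.update_apply]

variable [DecidableEq V]

/-- Assign the value `a` to the variable `x`. -/
def St.set (σ : St V) (x : V) (a : ℕ) : St V :=
  { σ with var := Function.update σ.var x a }

@[simp] theorem St.var_set (σ : St V) (x y : V) (a : ℕ) :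
    (σ.set x a).var y = if y = x then a else σ.var y := by
  simp [St.set, Function.update_apply]

@[simp] theorem St.mem_set (σ : St V) (x : V) (a : ℕ) : (σ.set x a).mem = σ.mem := rfl

/-- Weakest precondition: a sufficient condition for a command to end in a state with property
`Q`, such that all values stay below `M` and all loops have at most `D` rounds. -/
def Cmd.wp (M D : ℕ) : Cmd V → (St V → Prop) → St V → Prop
  | skip, Q, σ => Q σ
  | assign x e, Q, σ => e.Ok M σ ∧ Q (σ.set x (e.eval σ))
  | store a e, Q, σ => a.Ok M σ ∧ e.Ok M σ ∧ Q (σ.write (a.eval σ) (e.eval σ))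
  | seq s t, Q, σ => s.wp M D (t.wp M D Q) σ
  | ite e s t, Q, σ => e.Ok M σ ∧ (e.eval σ ≠ 0 → s.wp M D Q σ) ∧ (e.eval σ = 0 → t.wp M D Q σ)
  | loop x y b, Q, σ => x ≠ y ∧ x ∉ b.writes ∧ y ∉ b.writes ∧ σ.var y ≤ D ∧
      ∃ I : ℕ → St V → Prop, I 0 σ ∧
        (∀ j τ, j < σ.var y → I j τ → b.wp M D (I (j + 1)) (τ.set x j)) ∧
        ∀ τ, I (σ.var y) τ → Q (τ.set x (σ.var y))

theorem Cmd.wp_mono {M D : ℕ} {s : Cmd V} {Q Q' : St V → Prop} (h : ∀ τ, Q τ → Q' τ) {σ : St V}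
    (hs : s.wp M D Q σ) : s.wp M D Q' σ := by
  induction s generalizing Q Q' σ with
  | skip => exact h _ hs
  | assign x e => exact ⟨hs.1, h _ hs.2⟩
  | store a e => exact ⟨hs.1, hs.2.1, h _ hs.2.2⟩
  | seq s t ihs iht => exact ihs (fun τ hτ => iht h hτ) hs
  | ite e s t ihs iht => exact ⟨hs.1, fun he => ihs h (hs.2.1 he), fun he => iht h (hs.2.2 he)⟩
  | loop x y b _ =>
    obtain ⟨hxy, hx, hy, hD, I, hI0, hI, hQ⟩ := hs
    exact ⟨hxy, hx, hy, hD, I, hI0, hI, fun τ hτ => h _ (hQ τ hτ)⟩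

/-- The states `τ` and `σ` agree on all variables that `s` does not assign to. -/
def Cmd.Frame (s : Cmd V) (σ τ : St V) : Prop :=
  ∀ z, z ∉ s.writes → τ.var z = σ.var z

omit [DecidableEq V] in
theorem Cmd.Frame.seq {s t : Cmd V} {σ τ υ : St V} (hs : s.Frame σ τ) (ht : t.Frame τ υ) :
    (s.seq t).Frame σ υ := fun z hz => by
  simp only [writes, List.mem_append, not_or] at hz
  rw [ht z hz.2, hs z hz.1]

theorem Cmd.Frame.set_counter {x y : V} {b : Cmd V} {σ τ : St V}
    (h : (loop x y b).Frame σ τ) (j : ℕ) : (loop x y b).Frame σ (τ.set x j) := fun z hz => by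
  have hzx : z ≠ x := fun hzx => hz (hzx ▸ List.mem_cons_self)
  rw [St.var_set, if_neg hzx, h z hz]

theorem Cmd.Frame.loop {x y : V} {b : Cmd V} {σ τ υ : St V} {j : ℕ}
    (h : (loop x y b).Frame σ τ) (hb : b.Frame (τ.set x j) υ) : (loop x y b).Frame σ υ :=
  fun z hz => by
    rw [← h.set_counter j z hz]
    exact hb z fun hzb => hz (List.mem_cons_of_mem x hzb)

theorem Cmd.wp_frame {M D : ℕ} {s : Cmd V} {Q : St V → Prop} {σ : St V} (hs : s.wp M D Q σ) :
    s.wp M D (fun τ => Q τ ∧ s.Frame σ τ) σ := by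
  induction s generalizing Q σ with
  | skip => exact ⟨hs, fun _ _ => rfl⟩
  | assign x e => exact ⟨hs.1, hs.2, fun z hz => by simp_all [writes]⟩
  | store a e => exact ⟨hs.1, hs.2.1, hs.2.2, fun _ _ => rfl⟩
  | seq s t ihs iht =>
    exact wp_mono (fun τ hτ => wp_mono (fun υ hυ => ⟨hυ.1, hτ.2.seq hυ.2⟩) (iht hτ.1)) (ihs hs)
  | ite e s t ihs iht =>
    exact ⟨hs.1,
      fun he => wp_mono (fun τ hτ => ⟨hτ.1, fun z hz => hτ.2 z fun h =>
        hz (List.mem_append_left _ h)⟩) (ihs (hs.2.1 he)),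
      fun he => wp_mono (fun τ hτ => ⟨hτ.1, fun z hz => hτ.2 z fun h =>
        hz (List.mem_append_right _ h)⟩) (iht (hs.2.2 he))⟩
  | loop x y b ih =>
    obtain ⟨hxy, hx, hy, hD, I, hI0, hI, hQ⟩ := hs
    refine ⟨hxy, hx, hy, hD, fun j τ => I j τ ∧ (loop x y b).Frame σ τ, ⟨hI0, fun _ _ => rfl⟩,
      fun j τ hj hτ => wp_mono (fun υ hυ => ⟨hυ.1, hτ.2.loop hυ.2⟩) (ih (hI j τ hj hτ.1)),
      fun τ hτ => ⟨hQ τ hτ.1, hτ.2.set_counter _⟩⟩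

theorem Cmd.wp_ite {M D : ℕ} {e : Ex V} {s t : Cmd V} {Q : St V → Prop} {σ : St V} (p : Prop)
    (he : e.Ok M σ) (hp : e.eval σ ≠ 0 ↔ p) (hs : p → s.wp M D Q σ) (ht : ¬p → t.wp M D Q σ) :
    (ite e s t).wp M D Q σ :=
  ⟨he, fun h => hs (hp.1 h), fun h => ht fun hh => hp.2 hh h⟩

theorem Cmd.wp_loop {M D : ℕ} {x y : V} {b : Cmd V} {Q : St V → Prop} {σ : St V}
    (I : ℕ → St V → Prop) (hxy : x ≠ y) (hx : x ∉ b.writes) (hy : y ∉ b.writes)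
    (hD : σ.var y ≤ D) (h0 : I 0 σ)
    (hI : ∀ j τ, j < σ.var y → (loop x y b).Frame σ (τ.set x j) → I j τ →
      b.wp M D (I (j + 1)) (τ.set x j))
    (hQ : ∀ τ, (loop x y b).Frame σ (τ.set x (σ.var y)) → I (σ.var y) τ →
      Q (τ.set x (σ.var y))) :
    (loop x y b).wp M D Q σ :=
  ⟨hxy, hx, hy, hD, fun j τ => I j τ ∧ (loop x y b).Frame σ τ, ⟨h0, fun _ _ => rfl⟩,
    fun j τ hj hτ => wp_mono (fun _ hυ => ⟨hυ.1, hτ.2.loop hυ.2⟩)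
      (wp_frame (hI j τ hj (hτ.2.set_counter j) hτ.1)),
    fun τ hτ => hQ τ (hτ.2.set_counter _) hτ.1⟩

end Semantics

section Compile

variable {V : Type} {K : ℕ} (ρ : V ↪ Fin K)

/-- Machine code that leaves the value of an expression in register `d`, and uses only registers
from `d` on besides the registers `ρ x` of the variables `x`. -/
def Ex.compile : Ex V → ℕ → List Instr
  | lit n, d => [.const d n]
  | var x, d => [.copy d (ρ x)]
  | op o a b, d => a.compile d ++ (b.compile (d + 1) ++ [.op o d d (d + 1)])
  | load a, d => a.compile d ++ [.load d d]

/-- Machine code for a command, to be placed at position `pos`; registers from `K` on are used for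
intermediate results. -/
def Cmd.compile : Cmd V → ℕ → List Instr
  | skip, _ => []
  | assign x e, _ => e.compile ρ K ++ [.copy (ρ x) K]
  | store a e, _ => a.compile ρ K ++ (e.compile ρ (K + 1) ++ [.store K (K + 1)])
  | seq s t, pos => s.compile pos ++ t.compile (pos + (s.compile pos).length)
  | ite e s t, pos =>
      let ce := e.compile ρ K
      let ps := pos + ce.length + 1
      let cs := s.compile ps
      let pt := ps + cs.length + 1
      let ct := t.compile pt
      ce ++ (.jumpZero K pt :: (cs ++ (.jump (pt + ct.length) :: ct)))
  | loop x y b, pos =>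
      let cb := b.compile (pos + 3)
      .const (ρ x) 0 :: .op .lt K (ρ x) (ρ y) :: .jumpZero K (pos + 3 + cb.length + 3) ::
        (cb ++ [.const K 1, .op .add (ρ x) (ρ x) K, .jump (pos + 1)])

/-- A bound for the number of steps of the compiled command, as a polynomial in a bound for the
number of rounds of each loop. -/
noncomputable def Cmd.time : Cmd V → Polynomial ℕ
  | skip => 0
  | assign x e => (((assign x e).compile ρ 0).length : Polynomial ℕ)
  | store a e => (((store a e).compile ρ 0).length : Polynomial ℕ)
  | seq s t => s.time + t.time
  | ite e s t => (((e.compile ρ K).length + 2 : ℕ) : Polynomial ℕ) + (s.time + t.time)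
  | loop _ _ b => 3 + Polynomial.X * (b.time + 5)

end Compile

/-- The list `L` of instructions stands at position `pos` of the program `P`. -/
def CodeAt (P : Program) (pos : ℕ) (L : List Instr) : Prop :=
  ∀ i (h : i < L.length), P[pos + i]? = some L[i]

theorem CodeAt.append {P : Program} {pos : ℕ} {L L' : List Instr} (h : CodeAt P pos (L ++ L')) :
    CodeAt P pos L ∧ CodeAt P (pos + L.length) L' := by
  constructor
  · intro i hi
    rw [h i (by simp; omega), List.getElem_append_left hi]
  · intro i hi
    rw [add_assoc, h (L.length + i) (by simp; omega), List.getElem_append_right (by omega)]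
    simp

theorem CodeAt.tail {P : Program} {pos : ℕ} {a : Instr} {L : List Instr}
    (h : CodeAt P pos (a :: L)) : CodeAt P (pos + 1) L :=
  (CodeAt.append (L := [a]) h).2

/-- The machine goes from `c` to `c'` in at most `T` steps. -/
def Reaches (W : ℕ) (P : Program) (T : ℕ) (c c' : Config) : Prop :=
  ∃ t ≤ T, (step W P)^[t] c = c'

section Reaches

variable {W T T' : ℕ} {P : Program} {c c' c'' : Config}

theorem Reaches.trans (h : Reaches W P T c c') (h' : Reaches W P T' c' c'') :
    Reaches W P (T + T') c c'' := by
  obtain ⟨t, ht, rfl⟩ := h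
  obtain ⟨t', ht', rfl⟩ := h'
  exact ⟨t' + t, by omega, Function.iterate_add_apply _ _ _ _⟩

theorem Reaches.mono (h : Reaches W P T c c') (hT : T ≤ T') : Reaches W P T' c c' :=
  let ⟨t, ht, h⟩ := h
  ⟨t, ht.trans hT, h⟩

theorem Reaches.exec {pos : ℕ} {I : Instr} {L : List Instr} (h : CodeAt P pos (I :: L))
    (hpc : c.pc = pos) : Reaches W P 1 c (I.exec W c) := by
  have hI : P[c.pc]? = some I := hpc ▸ h 0 (Nat.succ_pos _)
  exact ⟨1, le_rfl, by simp [step, hI]⟩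

end Reaches

/-- The machine configuration `c` represents the state `σ`: the value of the variable `x` is in
register `ρ x`, the memories are the same, and all values are machine words. -/
structure Rel {V : Type} {K : ℕ} (ρ : V ↪ Fin K) (W : ℕ) (σ : St V) (c : Config) : Prop where
  var : ∀ x, c.reg (ρ x) = σ.var x
  var_lt : ∀ x, σ.var x < 2 ^ W
  mem : c.mem = σ.mem
  mem_lt : ∀ a, σ.mem a < 2 ^ W

section Correctness

variable {V : Type} {K : ℕ} {ρ : V ↪ Fin K} {W D : ℕ} {P : Program} {σ : St V} {c : Config}

theorem Rel.of_agree {c' : Config} (h : Rel ρ W σ c) (hr : ∀ r < K, c'.reg r = c.reg r)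
    (hm : c'.mem = c.mem) : Rel ρ W σ c' :=
  ⟨fun x => (hr _ (ρ x).isLt).trans (h.var x), h.var_lt, hm.trans h.mem, h.mem_lt⟩

theorem Rel.jump (h : Rel ρ W σ c) (pc : ℕ) : Rel ρ W σ { c with pc := pc } :=
  h.of_agree (fun _ _ => rfl) rfl

theorem Rel.setReg_temporary (h : Rel ρ W σ c) {d : ℕ} (hd : K ≤ d) (v : ℕ) :
    Rel ρ W σ (c.setReg W d v) :=
  h.of_agree (fun _ hr => Function.update_of_ne (hr.trans_le hd).ne _ _) rfl

theorem Rel.setReg_var [DecidableEq V] (h : Rel ρ W σ c) (x : V) {v : ℕ} (hv : v < 2 ^ W) :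
    Rel ρ W (σ.set x v) (c.setReg W (ρ x) v) := by
  refine ⟨fun y => ?_, fun y => ?_, h.mem, h.mem_lt⟩
  · simp only [Config.setReg, Nat.mod_eq_of_lt hv, Function.update_apply, St.var_set, h.var,
      Fin.val_inj, ρ.injective.eq_iff]
  · rw [St.var_set]
    split_ifs
    exacts [hv, h.var_lt y]

theorem Rel.store (h : Rel ρ W σ c) {a b : ℕ} (hb : c.reg b < 2 ^ W) :
    Rel ρ W (σ.write (c.reg a) (c.reg b)) ((Instr.store a b).exec W c) := by
  refine ⟨h.var, h.var_lt, ?_, fun i => ?_⟩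
  · simp only [Instr.exec, h.mem, St.write]
  · rw [St.mem_write]
    split_ifs
    exacts [hb, h.mem_lt i]

theorem Ex.eval_lt (hW : 0 < W) (h : Rel ρ W σ c) {e : Ex V} (he : e.Ok (2 ^ W) σ) :
    e.eval σ < 2 ^ W := by
  induction e with
  | lit n => exact he
  | var x => exact h.var_lt x
  | op o a b iha ihb => exact (he.2.2.eval_mod hW (iha he.1) (ihb he.2.1)).1
  | load a => exact h.mem_lt _

theorem Ex.reaches_compile (hW : 0 < W) {e : Ex V} (he : e.Ok (2 ^ W) σ) {d : ℕ} (hd : K ≤ d)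
    (h : Rel ρ W σ c) {pos : ℕ} (hc : CodeAt P pos (e.compile ρ d)) (hpc : c.pc = pos) :
    ∃ c', Reaches W P (e.compile ρ d).length c c' ∧ c'.pc = pos + (e.compile ρ d).length ∧
      c'.reg d = e.eval σ ∧ (∀ r < d, c'.reg r = c.reg r) ∧ c'.mem = c.mem := by
  induction e generalizing d c pos with
  | lit n =>
    refine ⟨_, .exec hc hpc, congrArg (· + 1) hpc, ?_,
      fun r hr => Function.update_of_ne hr.ne _ _, rfl⟩
    exact (Function.update_self ..).trans (Nat.mod_eq_of_lt he)
  | var x =>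
    refine ⟨_, .exec hc hpc, congrArg (· + 1) hpc, ?_,
      fun r hr => Function.update_of_ne hr.ne _ _, rfl⟩
    refine (Function.update_self ..).trans ?_
    rw [h.var x]
    exact Nat.mod_eq_of_lt (h.var_lt x)
  | op o a b iha ihb =>
    obtain ⟨hca, hcbo⟩ := hc.append
    obtain ⟨hcb, hco⟩ := hcbo.append
    obtain ⟨c₁, h₁, hp₁, hv₁, hr₁, hm₁⟩ := iha he.1 hd h hca hpc
    have hR₁ : Rel ρ W σ c₁ := h.of_agree (fun r hr => hr₁ r (by omega)) hm₁
    obtain ⟨c₂, h₂, hp₂, hv₂, hr₂, hm₂⟩ := ihb he.2.1 (hd.trans d.le_succ) hR₁ hcb hp₁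
    refine ⟨_, ((h₁.trans h₂).trans (.exec hco hp₂)).mono ?_, ?_, ?_, fun r hr => ?_,
      hm₂.trans hm₁⟩
    · simp [compile, add_assoc]
    · simp [Instr.exec, Config.setReg, compile, hp₂, add_assoc]
    · refine (Function.update_self ..).trans ?_
      rw [hv₂, hr₂ d d.lt_succ_self, hv₁]
      exact (he.2.2.eval_mod hW (eval_lt hW h he.1) (eval_lt hW h he.2.1)).2
    · refine (Function.update_of_ne hr.ne _ _).trans ?_
      rw [hr₂ r (by omega), hr₁ r hr]
  | load a ih =>
    obtain ⟨hca, hco⟩ := hc.append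
    obtain ⟨c₁, h₁, hp₁, hv₁, hr₁, hm₁⟩ := ih he hd h hca hpc
    refine ⟨_, (h₁.trans (.exec hco hp₁)).mono ?_, ?_, ?_, fun r hr => ?_, hm₁⟩
    · simp [compile]
    · simp [Instr.exec, Config.setReg, compile, hp₁, add_assoc]
    · refine (Function.update_self ..).trans ?_
      rw [hv₁, hm₁, h.mem]
      exact Nat.mod_eq_of_lt (h.mem_lt _)
    · exact (Function.update_of_ne hr.ne _ _).trans (hr₁ r hr)

theorem Cmd.reaches_loop_head (hW : 0 < W) {x y : V} {b : Cmd V} {pos : ℕ}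
    (hc : CodeAt P pos ((loop x y b).compile ρ pos)) (h : Rel ρ W σ c) (hpc : c.pc = pos + 1) :
    ∃ c', Reaches W P 2 c c' ∧ Rel ρ W σ c' ∧
      c'.pc = if σ.var x < σ.var y then pos + 3 else pos + ((loop x y b).compile ρ pos).length := by
  have h1W : 1 < 2 ^ W := Nat.one_lt_two_pow hW.ne'
  let c₁ := (Instr.op .lt K (ρ x) (ρ y)).exec W c
  have hreg : c₁.reg K = if σ.var x < σ.var y then 1 else 0 := by
    refine (Function.update_self ..).trans ?_
    rw [BinOp.eval, h.var, h.var]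
    exact Nat.mod_eq_of_lt (by split_ifs <;> omega)
  have hpc₁ : c₁.pc = pos + 2 := congrArg (· + 1) hpc
  have hR₁ : Rel ρ W σ c₁ := h.setReg_temporary le_rfl _
  refine ⟨_, (Reaches.exec hc.tail hpc).trans (.exec hc.tail.tail hpc₁), hR₁.jump _, ?_⟩
  change (if c₁.reg K = 0 then _ else c₁.pc + 1) = _
  rw [hreg, hpc₁]
  split_ifs <;> simp_all [compile]
  omega

variable [DecidableEq V]

variable (ρ W D) in
/-- The compiled form of `s` realizes every weakest precondition of `s`, within the time bound
of `s`. -/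
def Cmd.Correct (s : Cmd V) : Prop :=
  ∀ ⦃P : Program⦄ ⦃pos : ℕ⦄ ⦃Q : St V → Prop⦄ ⦃σ : St V⦄ ⦃c : Config⦄, s.wp (2 ^ W) D Q σ →
    Rel ρ W σ c → CodeAt P pos (s.compile ρ pos) → c.pc = pos →
    ∃ c' σ', Reaches W P ((s.time ρ).eval D) c c' ∧ c'.pc = pos + (s.compile ρ pos).length ∧
      Rel ρ W σ' c' ∧ Q σ'

theorem Cmd.correct_skip : (skip : Cmd V).Correct ρ W D := fun _ _ _ σ c hs h _ hpc =>
  ⟨c, σ, ⟨0, Nat.zero_le _, rfl⟩, hpc, h, hs⟩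

theorem Cmd.correct_assign (hW : 0 < W) (x : V) (e : Ex V) : (assign x e).Correct ρ W D := by
  intro P pos Q σ c hs h hc hpc
  obtain ⟨he, hQ⟩ := hs
  obtain ⟨hce, hco⟩ := hc.append
  obtain ⟨c₁, h₁, hp₁, hv₁, hr₁, hm₁⟩ := e.reaches_compile hW he le_rfl h hce hpc
  have hR₁ : Rel ρ W σ c₁ := h.of_agree hr₁ hm₁
  have hR₂ := hR₁.setReg_var x (Ex.eval_lt hW h he)
  rw [← hv₁] at hR₂ hQ
  refine ⟨_, _, (h₁.trans (.exec hco hp₁)).mono ?_, ?_, hR₂, hQ⟩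
  · simp [time, compile]
  · simp [Instr.exec, Config.setReg, compile, hp₁, add_assoc]

theorem Cmd.correct_store (hW : 0 < W) (a e : Ex V) : (store a e).Correct ρ W D := by
  intro P pos Q σ c hs h hc hpc
  obtain ⟨ha, he, hQ⟩ := hs
  obtain ⟨hca, hceo⟩ := hc.append
  obtain ⟨hce, hco⟩ := hceo.append
  obtain ⟨c₁, h₁, hp₁, hv₁, hr₁, hm₁⟩ := a.reaches_compile hW ha le_rfl h hca hpc
  have hR₁ : Rel ρ W σ c₁ := h.of_agree hr₁ hm₁
  obtain ⟨c₂, h₂, hp₂, hv₂, hr₂, hm₂⟩ := e.reaches_compile hW he K.le_succ hR₁ hce hp₁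
  have hR₂ : Rel ρ W σ c₂ := hR₁.of_agree (fun r hr => hr₂ r (hr.trans K.lt_succ_self)) hm₂
  have hlt : c₂.reg (K + 1) < 2 ^ W := hv₂ ▸ Ex.eval_lt hW h he
  rw [← hv₁, ← hr₂ K K.lt_succ_self, ← hv₂] at hQ
  refine ⟨_, _, ((h₁.trans h₂).trans (.exec hco hp₂)).mono ?_, ?_, hR₂.store hlt, hQ⟩
  · simp [time, compile, add_assoc]
  · simp [Instr.exec, compile, hp₂, add_assoc]

theorem Cmd.Correct.seq {s t : Cmd V} (hs : s.Correct ρ W D) (ht : t.Correct ρ W D) :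
    (s.seq t).Correct ρ W D := by
  intro P pos Q σ c hwp h hc hpc
  obtain ⟨hcs, hct⟩ := hc.append
  obtain ⟨c₁, σ₁, h₁, hp₁, hR₁, hQ₁⟩ := hs hwp h hcs hpc
  obtain ⟨c₂, σ₂, h₂, hp₂, hR₂, hQ₂⟩ := ht hQ₁ hR₁ hct hp₁
  exact ⟨c₂, σ₂, (h₁.trans h₂).mono (by simp [time]), by simp [hp₂, compile, add_assoc], hR₂, hQ₂⟩

theorem Cmd.Correct.ite (hW : 0 < W) (e : Ex V) {s t : Cmd V} (hs : s.Correct ρ W D)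
    (ht : t.Correct ρ W D) : (ite e s t).Correct ρ W D := by
  intro P pos Q σ c hwp h hc hpc
  obtain ⟨he, hQs, hQt⟩ := hwp
  obtain ⟨hce, hcz⟩ := hc.append
  obtain ⟨hcs, hcj⟩ := hcz.tail.append
  obtain ⟨c₁, h₁, hp₁, hv₁, hr₁, hm₁⟩ := e.reaches_compile hW he le_rfl h hce hpc
  have h₂ : Reaches W P 1 c₁ _ := .exec hcz hp₁
  have hR₂ := fun pc => (h.of_agree hr₁ hm₁).jump pc
  by_cases h0 : e.eval σ = 0
  · obtain ⟨c₃, σ₃, h₃, hp₃, hR₃, hQ₃⟩ := ht (hQt h0) (hR₂ _) hcj.tail (if_pos (hv₁.trans h0))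
    refine ⟨c₃, σ₃, ((h₁.trans h₂).trans h₃).mono ?_, ?_, hR₃, hQ₃⟩
    · simp [time]; omega
    · rw [hp₃]; simp [compile]; omega
  · obtain ⟨c₃, σ₃, h₃, hp₃, hR₃, hQ₃⟩ := hs (hQs h0) (hR₂ _) hcs
      ((if_neg fun h => h0 (hv₁.symm.trans h)).trans (congrArg (· + 1) hp₁))
    refine ⟨_, σ₃, (((h₁.trans h₂).trans h₃).trans (.exec hcj hp₃)).mono ?_, ?_, hR₃.jump _, hQ₃⟩
    · simp [time]; omega
    · simp [compile, Instr.exec]; omega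

theorem Cmd.Correct.loop_round (hW : 0 < W) {x y : V} {b : Cmd V} (hb : b.Correct ρ W D)
    (hxy : x ≠ y) (hx : x ∉ b.writes) (hy : y ∉ b.writes) {pos : ℕ}
    (hc : CodeAt P pos ((loop x y b).compile ρ pos)) {I : St V → Prop} {τ : St V} {j : ℕ}
    (hj : j < τ.var y) (hI : b.wp (2 ^ W) D I (τ.set x j)) (h : Rel ρ W (τ.set x j) c)
    (hpc : c.pc = pos + 1) :
    ∃ c' τ', Reaches W P ((b.time ρ).eval D + 5) c c' ∧ c'.pc = pos + 1 ∧
      Rel ρ W (τ'.set x (j + 1)) c' ∧ I τ' ∧ τ'.var y = τ.var y := by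
  obtain ⟨hcb, hci⟩ := hc.tail.tail.tail.append
  obtain ⟨c₁, h₁, hR₁, hp₁⟩ := reaches_loop_head hW hc h hpc
  rw [if_pos (by simpa [hxy.symm] using hj)] at hp₁
  obtain ⟨c₂, τ', h₂, hp₂, hR₂, hIτ', hfr⟩ := hb (wp_frame hI) hR₁ hcb hp₁
  have hx' : τ'.var x = j := by rw [hfr x hx]; simp
  have hy' : τ'.var y = τ.var y := by rw [hfr y hy]; simp [hxy.symm]
  have hlt : τ'.var x + 1 < 2 ^ W := by have := hR₂.var_lt y; omega
  have hp₃ : ((Instr.const K 1).exec W c₂).pc = _ := congrArg (· + 1) hp₂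
  have hR₃ : Rel ρ W τ' ((Instr.const K 1).exec W c₂) := hR₂.setReg_temporary le_rfl _
  set c₃ := (Instr.const K 1).exec W c₂
  have hone : c₃.reg K = 1 :=
    (Function.update_self ..).trans (Nat.mod_eq_of_lt (Nat.one_lt_two_pow hW.ne'))
  have hp₄ : ((Instr.op .add (ρ x) (ρ x) K).exec W c₃).pc = _ := congrArg (· + 1) hp₃
  have hR₄ := hR₃.setReg_var x hlt
  rw [← hR₃.var x, ← hone] at hR₄
  have hlast := (Reaches.exec hci hp₂).trans
    ((Reaches.exec hci.tail hp₃).trans (.exec hci.tail.tail hp₄))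
  refine ⟨_, τ', ((h₁.trans h₂).trans hlast).mono (by omega), rfl, ?_, hIτ', hy'⟩
  rw [← hx', ← hR₃.var x]
  exact hone ▸ hR₄.jump _

theorem Cmd.Correct.loop (hW : 0 < W) (x y : V) {b : Cmd V} (hb : b.Correct ρ W D) :
    (loop x y b).Correct ρ W D := by
  intro P pos Q σ c hwp h hc hpc
  obtain ⟨hxy, hx, hy, hD, I, hI0, hI, hQ⟩ := hwp
  have hrounds : ∀ j ≤ σ.var y, ∃ c' τ, Reaches W P (1 + j * ((b.time ρ).eval D + 5)) c c' ∧
      c'.pc = pos + 1 ∧ Rel ρ W (τ.set x j) c' ∧ I j τ ∧ τ.var y = σ.var y := by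
    intro j
    induction j with
    | zero =>
      exact fun _ => ⟨_, σ, (Reaches.exec hc hpc).mono (Nat.le_add_right _ _),
        congrArg (· + 1) hpc, h.setReg_var x (Nat.two_pow_pos W), hI0, rfl⟩
    | succ j ih =>
      intro hj
      obtain ⟨c₁, τ, h₁, hp₁, hR₁, hIτ, hτy⟩ := ih (Nat.le_of_succ_le hj)
      obtain ⟨c₂, τ', h₂, hp₂, hR₂, hIτ', hτy'⟩ :=
        hb.loop_round hW hxy hx hy hc (hτy ▸ hj) (hI j τ hj hIτ) hR₁ hp₁
      exact ⟨c₂, τ', (h₁.trans h₂).mono (by rw [add_mul]; omega), hp₂, hR₂, hIτ',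
        hτy'.trans hτy⟩
  obtain ⟨c₁, τ, h₁, hp₁, hR₁, hIτ, hτy⟩ := hrounds _ le_rfl
  obtain ⟨c₂, h₂, hR₂, hp₂⟩ := reaches_loop_head hW hc hR₁ hp₁
  rw [if_neg (by simp [hxy.symm, hτy])] at hp₂
  refine ⟨c₂, _, (h₁.trans h₂).mono ?_, hp₂, hR₂, hQ τ hIτ⟩
  have := Nat.mul_le_mul_right ((b.time ρ).eval D + 5) hD
  simp only [time, Polynomial.eval_add, Polynomial.eval_mul, Polynomial.eval_X,
    Polynomial.eval_ofNat]
  omega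

theorem Cmd.correct (hW : 0 < W) (s : Cmd V) : s.Correct ρ W D := by
  induction s with
  | skip => exact correct_skip
  | assign x e => exact correct_assign hW x e
  | store a e => exact correct_store hW a e
  | seq s t ihs iht => exact ihs.seq iht
  | ite e s t ihs iht => exact ihs.ite hW e iht
  | loop x y b ih => exact ih.loop hW x y

/-- The state in which a program is started: the input stands in the first memory cells. -/
def St.init (input : List ℕ) : St V :=
  { var := fun _ => 0, mem := fun a => input.getD a 0 }

theorem Cmd.computesWithin_compile (hW : 0 < W) {start size : V} (hstart : (ρ start : ℕ) = 0)
    (hsize : (ρ size : ℕ) = 1) {s : Cmd V} {input output : List ℕ}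
    (hinput : ∀ a ∈ input, a < 2 ^ W)
    (hs : s.wp (2 ^ W) D (fun τ => τ.var size = output.length ∧
      τ.var start + output.length ≤ 2 ^ W ∧
      ∀ (i : ℕ) (h : i < output.length), τ.mem (τ.var start + i) = output[i]) (.init input)) :
    ComputesWithin W (s.compile ρ 0) input ((s.time ρ).eval D) output := by
  have hinit : Rel ρ W (.init input) (init input) := by
    refine ⟨fun _ => rfl, fun _ => Nat.two_pow_pos W, rfl, fun a => ?_⟩
    rcases lt_or_ge a input.length with ha | ha
    · exact (List.getD_eq_getElem input 0 ha).trans_lt (hinput _ (List.getElem_mem ha))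
    · exact (List.getD_eq_default input 0 ha).trans_lt (Nat.two_pow_pos W)
  have hcode : CodeAt (s.compile ρ 0) 0 (s.compile ρ 0) := fun i hi => by simp [hi]
  obtain ⟨_, τ, ⟨t, ht, rfl⟩, hpc, hR, hlen, hle, hout⟩ := s.correct hW hs hinit hcode rfl
  refine ⟨t, ht, by rw [Halted, hpc, zero_add], ?_⟩
  have h0 := hR.var start
  have h1 := hR.var size
  rw [hstart] at h0
  rw [hsize] at h1
  rw [Outputs, h0, h1, hR.mem]
  exact ⟨hlen, hle, hout⟩

end Correctness

end WordRAM

/-! ### The words and tables of the matching program -/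

/-- The word of length `n` that stands in the memory `mem` from the address `a` on. -/
def wordAt (mem : ℕ → ℕ) (a n : ℕ) : List ℕ :=
  (List.range n).map fun i => mem (a + i)

theorem wordAt_succ (mem : ℕ → ℕ) (a n : ℕ) :
    wordAt mem a (n + 1) = wordAt mem a n ++ [mem (a + n)] := by
  simp [wordAt, List.range_succ]

theorem wordAt_congr {mem mem' : ℕ → ℕ} {a n : ℕ} (h : ∀ i < n, mem (a + i) = mem' (a + i)) :
    wordAt mem a n = wordAt mem' a n :=
  List.map_congr_left fun i hi => h i (List.mem_range.1 hi)

@[simp] theorem length_wordAt (mem : ℕ → ℕ) (a n : ℕ) : (wordAt mem a n).length = n := by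
  simp [wordAt]

/-- The three-dimensional table of the numbers `binomKernel j u v`, for all `j` below `S` and all
words `u` and `v` of lengths `r` and `c` below `S` that stand from the addresses `a` and `b` on. It
is linearly ordered: the entry with coordinates `(j, r, c)` has number `(j * S + r) * S + c`. -/
def kernelTable (mem : ℕ → ℕ) (a b S t : ℕ) : ℕ :=
  binomKernel (t / S / S) (wordAt mem a (t / S % S)) (wordAt mem b (t % S))

section KernelTable

variable {mem : ℕ → ℕ} {a b S : ℕ}

theorem tableIndex_lt {j r c : ℕ} (hj : j < S) (hr : r < S) (hc : c < S) :
    (j * S + r) * S + c < S * S * S := by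
  have : j * S + r < S * S := by nlinarith
  nlinarith

theorem mul_add_div_mod {d e : ℕ} (he : e < S) : (d * S + e) / S = d ∧ (d * S + e) % S = e :=
  (Nat.div_mod_unique (by omega)).2 ⟨by ring, he⟩

theorem kernelTable_mul_add {r c : ℕ} (hr : r < S) (hc : c < S) (j : ℕ) :
    kernelTable mem a b S ((j * S + r) * S + c) =
      binomKernel j (wordAt mem a r) (wordAt mem b c) := by
  rw [kernelTable, (mul_add_div_mod hc).1, (mul_add_div_mod hc).2, (mul_add_div_mod hr).1,
    (mul_add_div_mod hr).2]

theorem kernelTable_of_lt {t : ℕ} (ht : t < S * S) : kernelTable mem a b S t = 1 := by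
  rw [kernelTable, Nat.div_div_eq_div_mul, Nat.div_eq_of_lt ht, binomKernel_zero]

theorem kernelTable_of_mul_eq_zero {t : ℕ} (hS : 0 < S) (ht : S * S ≤ t)
    (h : t / S % S * (t % S) = 0) : kernelTable mem a b S t = 0 := by
  obtain ⟨j, hj⟩ := Nat.exists_eq_succ_of_ne_zero
    (Nat.div_pos ht (Nat.mul_pos hS hS)).ne'
  rw [kernelTable, Nat.div_div_eq_div_mul, hj]
  rcases mul_eq_zero.1 h with h | h <;> rw [h]
  exacts [binomKernel_nil_left _ _, binomKernel_nil_right _ _]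

theorem kernelTable_add {t : ℕ} (hS : 0 < S) (ht : S * S ≤ t) (h : t / S % S * (t % S) ≠ 0) :
    S * S + S + 1 ≤ t ∧ kernelTable mem a b S t + kernelTable mem a b S (t - S - 1) =
      kernelTable mem a b S (t - 1) + kernelTable mem a b S (t - S) +
        (if mem (a + (t / S % S - 1)) = mem (b + (t % S - 1)) then 1 else 0) *
          kernelTable mem a b S (t - S * S - S - 1) := by
  obtain ⟨j, hj⟩ := Nat.exists_eq_add_one_of_ne_zero (Nat.div_pos ht (Nat.mul_pos hS hS)).ne'
  obtain ⟨r, hr⟩ := Nat.exists_eq_add_one_of_ne_zero (left_ne_zero_of_mul h)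
  obtain ⟨c, hc⟩ := Nat.exists_eq_add_one_of_ne_zero (right_ne_zero_of_mul h)
  have hrS : r + 1 < S := hr ▸ Nat.mod_lt _ hS
  have hcS : c + 1 < S := hc ▸ Nat.mod_lt _ hS
  have hcoord : t = ((j + 1) * S + (r + 1)) * S + (c + 1) := by
    rw [← hj, ← hr, ← hc, ← Nat.div_div_eq_div_mul, Nat.div_add_mod', Nat.div_add_mod']
  have hexp : t = (j * S + r) * S + c + (S * S + S + 1) := by rw [hcoord]; ring
  have h₁ : t - S - 1 = ((j + 1) * S + r) * S + c := by
    have : ((j + 1) * S + r) * S + c = (j * S + r) * S + c + S * S := by ring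
    omega
  have h₂ : t - 1 = ((j + 1) * S + (r + 1)) * S + c := by omega
  have h₃ : t - S = ((j + 1) * S + r) * S + (c + 1) := by
    have : ((j + 1) * S + r) * S + (c + 1) = (j * S + r) * S + c + S * S + 1 := by ring
    omega
  have h₄ : t - S * S - S - 1 = (j * S + r) * S + c := by omega
  refine ⟨by omega, ?_⟩
  rw [h₁, h₂, h₃, h₄, hr, hc, Nat.add_sub_cancel, Nat.add_sub_cancel, hcoord,
    kernelTable_mul_add hrS hcS, kernelTable_mul_add (by omega) (by omega),
    kernelTable_mul_add hrS (by omega), kernelTable_mul_add (by omega) hcS,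
    kernelTable_mul_add (by omega) (by omega), wordAt_succ, wordAt_succ, ite_mul, one_mul,
    zero_mul, binomKernel_concat_concat, add_comm (binomKernel (j + 1) _ (wordAt mem b c))]

end KernelTable

theorem add_add_sub_add_mod {m A B C E X : ℕ} (e : ℕ) (hm : 0 < m) (h : X + C = A + B + e * E) :
    (A % m + B % m + (m - C % m) + e * (E % m)) % m = X % m := by
  have hC : C % m ≤ m := (Nat.mod_lt C hm).le
  refine Nat.ModEq.add_right_cancel' (C % m) ?_
  calc A % m + B % m + (m - C % m) + e * (E % m) + C % m
      = A % m + B % m + e * (E % m) + m := by omega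
    _ ≡ A + B + e * E + 0 [MOD m] :=
        (((Nat.mod_modEq A m).add (Nat.mod_modEq B m)).add ((Nat.mod_modEq E m).mul_left e)).add
          (by simp [Nat.ModEq])
    _ = X + C := h.symm
    _ ≡ X + C % m [MOD m] := (Nat.mod_modEq C m).symm.add_left X

/-! ### The matching program -/

namespace WordRAM

/-- The variables of the matching program. After the preparation, `size` is the size of the input,
`lx` is the length of the second word, `xa` its address, `num` is one more than the length of the
first word, `ord` is the number of orders to be tested, `mods` is the number of moduli, and the
three tables of `vol` entries each start from the addresses `tab₁`, `tab₂`, `tab₃`. -/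
inductive Var where
  | out | cnt | size | lx | xa | num | pairs | ord | mods | vol | tab₁ | tab₂ | tab₃
  | nd | i | cap | q | pos | len | ua | r | m | t | j | ok
  deriving DecidableEq

/-- The register of each variable. -/
def Var.register : Var ↪ Fin 25 where
  toFun x := ⟨x.ctorIdx, by cases x <;> decide⟩
  inj' x y h := by cases x <;> cases y <;> first | rfl | cases h

instance : Coe Var (Ex Var) := ⟨Ex.var⟩

local infixl:65 " +ₑ " => Ex.op BinOp.add
local infixl:65 " -ₑ " => Ex.op BinOp.sub
local infixl:70 " *ₑ " => Ex.op BinOp.mul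
local infixl:70 " /ₑ " => Ex.op BinOp.div
local infixl:70 " %ₑ " => Ex.op BinOp.rem
local infix:50 " =ₑ " => Ex.op BinOp.eq
local infix:50 " <ₑ " => Ex.op BinOp.lt
local infixr:40 " ;; " => Cmd.seq

open Var in
/-- The entry `t` of the table of `binomKernel` modulo `m`, computed from preceding entries. -/
def recurrence (a b base : Var) : Ex Var :=
  (.load (base +ₑ (t -ₑ .lit 1)) +ₑ .load (base +ₑ (t -ₑ size)) +ₑ
      (m -ₑ .load (base +ₑ (t -ₑ size -ₑ .lit 1))) +ₑ
    (.load (a +ₑ (t /ₑ size %ₑ size -ₑ .lit 1)) =ₑ .load (b +ₑ (t %ₑ size -ₑ .lit 1))) *ₑ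
      .load (base +ₑ (t -ₑ size *ₑ size -ₑ size -ₑ .lit 1))) %ₑ m

open Var in
/-- Store the entry `t` of the table of `binomKernel` modulo `m`. -/
def fillEntry (a b base : Var) : Cmd Var :=
  .ite (t <ₑ size *ₑ size) (.store (base +ₑ t) (.lit 1 %ₑ m))
    (.ite (t /ₑ size %ₑ size *ₑ (t %ₑ size)) (.store (base +ₑ t) (recurrence a b base))
      (.store (base +ₑ t) (.lit 0)))

/-- Fill the memory from `base` on with the table of `binomKernel` modulo `m`, for the words that
stand from `a` and from `b` on. -/
def fillTable (a b base : Var) : Cmd Var :=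
  .loop .t .vol (fillEntry a b base)

/-- The state `σ` is ready for `fillTable a b base`: the parameters are set, and the table is
disjoint from the words and inside the memory of `M` cells. -/
structure FillReady (M S : ℕ) (a b base : Var) (σ : St Var) : Prop where
  left_ne : a ≠ .t
  right_ne : b ≠ .t
  base_ne : base ≠ .t
  size_pos : 0 < S
  size_eq : σ.var .size = S
  vol_eq : σ.var .vol = S * S * S
  m_pos : 0 < σ.var .m
  m_le : 4 * σ.var .m ≤ M
  left_le : σ.var a + S ≤ σ.var base
  right_le : σ.var b + S ≤ σ.var base
  base_le : σ.var base + S * S * S ≤ M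

/-- The memory of `τ` is that of `σ` with the first `n` entries of the table filled in. -/
structure Filled (S : ℕ) (a b base : Var) (σ : St Var) (n : ℕ) (τ : St Var) : Prop where
  entry : ∀ i < n,
    τ.mem (σ.var base + i) = kernelTable σ.mem (σ.var a) (σ.var b) S i % σ.var .m
  outside : ∀ s, s < σ.var base ∨ σ.var base + S * S * S ≤ s → τ.mem s = σ.mem s

section FillTable

variable {M D S : ℕ} {a b base : Var} {σ τ : St Var}

theorem Filled.write {n : ℕ} (h : Filled S a b base σ n τ) (hn : n < S * S * S) {v : ℕ}
    (hv : v = kernelTable σ.mem (σ.var a) (σ.var b) S n % σ.var .m) :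
    Filled S a b base σ (n + 1) (τ.write (σ.var base + n) v) := by
  refine ⟨fun i hi => ?_, fun s hs => ?_⟩ <;> rw [St.mem_write]
  · rcases Nat.lt_succ_iff_lt_or_eq.1 hi with hi | rfl
    · rw [if_neg (by omega), h.entry i hi]
    · rw [if_pos rfl, hv]
  · rw [if_neg (by omega), h.outside s hs]

theorem recurrence_spec (h : FillReady M S a b base σ) (hτ : ∀ z, z ≠ .t → τ.var z = σ.var z)
    {n : ℕ} (hn : n < S * S * S) (hfill : Filled S a b base σ n τ) (ht : τ.var .t = n)
    (hSn : S * S ≤ n) (hrc : n / S % S * (n % S) ≠ 0) :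
    (recurrence a b base).Ok M τ ∧
      (recurrence a b base).eval τ =
        kernelTable σ.mem (σ.var a) (σ.var b) S n % σ.var .m := by
  obtain ⟨hle, hadd⟩ := kernelTable_add (mem := σ.mem) (a := σ.var a) (b := σ.var b)
    h.size_pos hSn hrc
  have hr := Nat.pos_of_ne_zero (left_ne_zero_of_mul hrc)
  have hc := Nat.pos_of_ne_zero (right_ne_zero_of_mul hrc)
  have hrS := Nat.mod_lt (n / S) h.size_pos
  have hcS := Nat.mod_lt n h.size_pos
  have hla := h.left_le
  have hlb := h.right_le
  have hbase := h.base_le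
  have hm := h.m_le
  have hma := hfill.outside (σ.var a + (n / S % S - 1)) (.inl (by omega))
  have hmb := hfill.outside (σ.var b + (n % S - 1)) (.inl (by omega))
  have hpos := h.size_pos
  have hlt := fun i => Nat.mod_lt (kernelTable σ.mem (σ.var a) (σ.var b) S i) h.m_pos
  have e₁ := hfill.entry (n - 1) (by omega)
  have e₂ := hfill.entry (n - S) (by omega)
  have e₃ := hfill.entry (n - S - 1) (by omega)
  have e₄ := hfill.entry (n - S * S - S - 1) (by omega)
  have l₁ := hlt (n - 1)
  have l₂ := hlt (n - S)
  have l₃ := hlt (n - S - 1)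
  have l₄ := hlt (n - S * S - S - 1)
  simp only [recurrence, Ex.Ok, Ex.eval, BinOp.Safe, BinOp.natEval, BinOp.eval, ht,
    hτ _ h.left_ne, hτ _ h.right_ne, hτ _ h.base_ne, hτ .size (by decide), hτ .m (by decide),
    h.size_eq, hma, hmb, e₁, e₂, e₃, e₄]
  refine ⟨?_, add_add_sub_add_mod _ h.m_pos hadd⟩
  split_ifs <;> simp only [one_mul, zero_mul, true_and, and_true] <;> (repeat' constructor) <;>
    omega

theorem wp_fillEntry (h : FillReady M S a b base σ) (hτ : ∀ z, z ≠ .t → τ.var z = σ.var z)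
    {n : ℕ} (hn : n < S * S * S) (hfill : Filled S a b base σ n τ) (ht : τ.var .t = n) :
    (fillEntry a b base).wp M D (Filled S a b base σ (n + 1)) τ := by
  have hbase := h.base_le
  have hleft := h.left_le
  have hpos := h.size_pos
  have hm := h.m_pos
  have hm' := h.m_le
  have hmod := Nat.mod_lt (n / S) hpos
  have hSS : S * S ≤ S * S * S := Nat.le_mul_of_pos_right _ hpos
  have hstore : ∀ e : Ex Var, e.Ok M τ →
      e.eval τ = kernelTable σ.mem (σ.var a) (σ.var b) S n % σ.var .m →
      (Cmd.store (base +ₑ .var .t) e).wp M D (Filled S a b base σ (n + 1)) τ := by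
    intro e he hv
    refine ⟨⟨trivial, trivial, ?_⟩, he, ?_⟩ <;>
      simp only [Ex.eval, BinOp.natEval, BinOp.eval, BinOp.Safe, ht, hτ _ h.base_ne]
    · omega
    · exact hfill.write hn hv
  have hprod : n / S % S * (n % S) < M :=
    (Nat.mul_le_mul hmod.le (Nat.mod_lt n hpos).le).trans_lt (by omega)
  have hsize := (hτ .size (by decide)).trans h.size_eq
  refine Cmd.wp_ite (n < S * S) ?_ ?_ (fun hlt => hstore _ ?_ ?_) fun hle =>
    Cmd.wp_ite (n / S % S * (n % S) ≠ 0) ?_ ?_ (fun hrc => ?_) fun hrc => hstore _ ?_ ?_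
  · simp only [Ex.Ok, Ex.eval, BinOp.Safe, hsize, true_and, and_true]
    omega
  · simp [Ex.eval, BinOp.natEval, BinOp.eval, hsize, ht]
  · simp only [Ex.Ok, BinOp.Safe, and_true]
    omega
  · simp only [Ex.eval, BinOp.natEval, BinOp.eval, hτ .m (by decide), kernelTable_of_lt hlt]
  · simpa only [Ex.Ok, Ex.eval, BinOp.Safe, BinOp.natEval, BinOp.eval, hsize, ht, true_and]
  · simp only [Ex.eval, BinOp.natEval, BinOp.eval, hsize, ht]
  · obtain ⟨hok, hval⟩ := recurrence_spec h hτ hn hfill ht (not_lt.1 hle) hrc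
    exact hstore _ hok hval
  · simp only [Ex.Ok]
    omega
  · rw [kernelTable_of_mul_eq_zero hpos (not_lt.1 hle) (not_ne_iff.1 hrc), Nat.zero_mod, Ex.eval]

theorem wp_fillTable_of_fillReady (h : FillReady M S a b base σ) (hD : S * S * S ≤ D)
    {Q : St Var → Prop}
    (hQ : ∀ τ, (fillTable a b base).Frame σ τ → Filled S a b base σ (S * S * S) τ → Q τ) :
    (fillTable a b base).wp M D Q σ := by
  refine Cmd.wp_loop (Filled S a b base σ) (by decide) List.not_mem_nil List.not_mem_nil
    (h.vol_eq.trans_le hD) ⟨fun i hi => absurd hi (Nat.not_lt_zero i), fun _ _ => rfl⟩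
    (fun n τ hn hfr hfill => ?_) fun τ hfr hfill =>
      hQ _ hfr ⟨h.vol_eq ▸ hfill.entry, hfill.outside⟩
  exact wp_fillEntry h (fun z hz => hfr z (by simpa [fillEntry, Cmd.writes] using hz))
    (h.vol_eq ▸ hn) ⟨hfill.entry, hfill.outside⟩ (by simp)

end FillTable

open Var in
/-- Nonzero if the tables modulo `m` satisfy the kernel identity of `binomEquiv_iff_binomKernel`
for the order `j`. -/
def identityMod : Ex Var :=
  (.load (tab₁ +ₑ ((j *ₑ size +ₑ len) *ₑ size +ₑ len)) +ₑ
      .load (tab₂ +ₑ ((j *ₑ size +ₑ lx) *ₑ size +ₑ lx))) %ₑ m =ₑ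
    .lit 2 *ₑ .load (tab₃ +ₑ ((j *ₑ size +ₑ len) *ₑ size +ₑ lx)) %ₑ m

open Var in
/-- Set `ok` to zero if the tables modulo `m` violate the kernel identity for some order below
`ord`. -/
def compareTables : Cmd Var :=
  .loop j ord (.ite identityMod .skip (.assign ok (.lit 0)))

open Var in
/-- The comparison of the factor at `ua` of length `len` and the second word, modulo `m`. -/
def testModulus : Cmd Var :=
  fillTable ua ua tab₁ ;; fillTable xa xa tab₂ ;; fillTable ua xa tab₃ ;; compareTables

open Var in
/-- Set `ok` to zero if the factor at `ua` of length `len` is not equivalent to the second word. -/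
def testFactor : Cmd Var :=
  .loop r mods (.assign m (r +ₑ .lit 1) ;; testModulus)

/-- The state `σ` is prepared for the search for the matches `(i, l)` of the input `(w, x, k)`, an
input of size `S`, on a machine with numbers below `M`. -/
structure Ready (M S : ℕ) (w x : List ℕ) (k : ℕ) (σ : St Var) : Prop where
  length_le : w.length + x.length + 3 ≤ S
  le_bound : 4 * (S * S * S) ≤ M
  size_eq : σ.var .size = S
  vol_eq : σ.var .vol = S * S * S
  tab₁_eq : σ.var .tab₁ = S * S * S
  tab₂_eq : σ.var .tab₂ = 2 * (S * S * S)
  tab₃_eq : σ.var .tab₃ = 3 * (S * S * S)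
  lx_eq : σ.var .lx = x.length
  xa_eq : σ.var .xa = w.length + 2
  num_eq : σ.var .num = w.length + 1
  pairs_eq : σ.var .pairs = (w.length + 1) * (w.length + 1)
  ord_eq : σ.var .ord = min k (S - 1) + 1
  mods_eq : σ.var .mods = 4 * S
  out_eq : σ.var .out = S
  left_eq : wordAt σ.mem 1 w.length = w
  right_eq : wordAt σ.mem (w.length + 2) x.length = x

section TestFactor

variable {M D S k n : ℕ} {w x u : List ℕ} {a b base : Var} {σ τ : St Var} {Q : St Var → Prop}

theorem Ready.of_agree (h : Ready M S w x k σ)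
    (hvar : ∀ z ∈ [Var.size, .vol, .tab₁, .tab₂, .tab₃, .lx, .xa, .num, .pairs, .ord, .mods, .out],
      τ.var z = σ.var z)
    (hmem : ∀ s < S, τ.mem s = σ.mem s) : Ready M S w x k τ := by
  have hS := h.length_le
  simp only [List.forall_mem_cons] at hvar
  obtain ⟨h₁, h₂, h₃, h₄, h₅, h₆, h₇, h₈, h₉, h₁₀, h₁₁, h₁₂, -⟩ := hvar
  exact ⟨h.length_le, h.le_bound, h₁.trans h.size_eq, h₂.trans h.vol_eq, h₃.trans h.tab₁_eq,
    h₄.trans h.tab₂_eq, h₅.trans h.tab₃_eq, h₆.trans h.lx_eq, h₇.trans h.xa_eq,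
    h₈.trans h.num_eq, h₉.trans h.pairs_eq, h₁₀.trans h.ord_eq, h₁₁.trans h.mods_eq,
    h₁₂.trans h.out_eq, (wordAt_congr fun i hi => hmem _ (by omega)).trans h.left_eq,
    (wordAt_congr fun i hi => hmem _ (by omega)).trans h.right_eq⟩

theorem nine_mul_le_cube (hS : 3 ≤ S) : 9 * S ≤ S * S * S :=
  Nat.mul_le_mul_right S (Nat.mul_le_mul hS hS)

theorem Ready.nine_mul_size_le (h : Ready M S w x k σ) : 9 * S ≤ S * S * S :=
  nine_mul_le_cube (by have := h.length_le; omega)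

/-- The word `v`, shorter than `S`, stands in the memory from the address in the variable `a` on,
and this address is at most `S`. -/
structure Located (S : ℕ) (a : Var) (v : List ℕ) (σ : St Var) : Prop where
  ne : a ≠ .t
  address_le : σ.var a ≤ S
  length_lt : v.length < S
  word_eq : wordAt σ.mem (σ.var a) v.length = v

/-- The state `σ` is prepared for the comparison of the factor `u`, which starts at the address
`ua`, and the second word `x` modulo `n`. -/
structure Testing (M S : ℕ) (w x : List ℕ) (k : ℕ) (u : List ℕ) (n : ℕ) (σ : St Var) : Prop
    extends Ready M S w x k σ where
  modulus_pos : 0 < n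
  modulus_le : n ≤ 4 * S
  m_eq : σ.var .m = n
  len_eq : σ.var .len = u.length
  factor_length_le : u.length ≤ w.length
  ua_le : σ.var .ua ≤ w.length + 1
  factor_eq : wordAt σ.mem (σ.var .ua) u.length = u

theorem Testing.of_agree (h : Testing M S w x k u n σ)
    (hvar : ∀ z ∉ [Var.t, .j, .ok], τ.var z = σ.var z)
    (hmem : ∀ s < S * S * S, τ.mem s = σ.mem s) : Testing M S w x k u n τ := by
  have hS := h.length_le
  have hnine := h.nine_mul_size_le
  have hlen := h.factor_length_le
  have hua := h.ua_le
  have hua' := hvar .ua (by decide)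
  refine ⟨h.toReady.of_agree (fun z hz => hvar z (by revert z; decide)) fun s hs => hmem s
    (by omega), h.modulus_pos, h.modulus_le, (hvar .m (by decide)).trans h.m_eq,
    (hvar .len (by decide)).trans h.len_eq, h.factor_length_le, hua'.trans_le h.ua_le, ?_⟩
  rw [hua']
  exact (wordAt_congr fun i hi => hmem _ (by omega)).trans h.factor_eq

theorem Testing.located_ua (h : Testing M S w x k u n σ) : Located S .ua u σ := by
  have := h.length_le
  have := h.factor_length_le
  have := h.ua_le
  exact ⟨by decide, by omega, by omega, h.factor_eq⟩

theorem Testing.located_xa (h : Testing M S w x k u n σ) : Located S .xa x σ := by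
  have := h.length_le
  have := h.xa_eq
  exact ⟨by decide, by omega, by omega, by rw [h.xa_eq, h.right_eq]⟩

theorem Testing.wp_fillTable (h : Testing M S w x k u n σ) {v v' : List ℕ} (ha : Located S a v σ)
    (hb : Located S b v' σ) {i : ℕ} (hi : 1 ≤ i) (hi' : i ≤ 3) (hbase : base ≠ .t)
    (hbase_eq : σ.var base = i * (S * S * S)) (hD : S * S * S ≤ D)
    (hQ : ∀ τ, (fillTable a b base).Frame σ τ → Testing M S w x k u n τ →
      (∀ s, s < i * (S * S * S) ∨ (i + 1) * (S * S * S) ≤ s → τ.mem s = σ.mem s) →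
      (∀ j < S, τ.mem (i * (S * S * S) + ((j * S + v.length) * S + v'.length)) =
        binomKernel j v v' % n) → Q τ) :
    (fillTable a b base).wp M D Q σ := by
  have hS := h.length_le
  have hnine := h.nine_mul_size_le
  have hM := h.le_bound
  have hlo := Nat.mul_le_mul_right (S * S * S) hi
  have hhi := Nat.mul_le_mul_right (S * S * S) hi'
  have haS := ha.address_le
  have hbS := hb.address_le
  have hm := h.m_eq
  have hn := h.modulus_le
  have hready : FillReady M S a b base σ := by
    constructor <;> first
      | exact h.size_eq | exact h.vol_eq | exact ha.ne | exact hb.ne | exact hbase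
      | exact hm.symm ▸ h.modulus_pos
      | omega
  refine wp_fillTable_of_fillReady hready hD fun τ hfr hfill => ?_
  have hout := hfill.outside
  have hentry := fun j (hj : j < S) =>
    hfill.entry _ (tableIndex_lt hj ha.length_lt hb.length_lt)
  rw [hbase_eq] at hout hentry
  rw [hm] at hentry
  refine hQ τ hfr (h.of_agree (fun z hz => hfr z ?_) fun s hs => hout s (.inl (by omega)))
    (fun s hs => hout s (by rwa [add_one_mul] at hs)) fun j hj => ?_
  · change z ∉ [Var.t]
    revert hz
    cases z <;> decide
  · rw [hentry j hj, kernelTable_mul_add ha.length_lt hb.length_lt, ha.word_eq, hb.word_eq]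

/-- The tables of `binomKernel` modulo `n` for two words `u` and `x` are stored in the memory. -/
structure Tables (S : ℕ) (u x : List ℕ) (n : ℕ) (mem : ℕ → ℕ) : Prop where
  left_left : ∀ j < S, mem (1 * (S * S * S) + ((j * S + u.length) * S + u.length)) =
    binomKernel j u u % n
  right_right : ∀ j < S, mem (2 * (S * S * S) + ((j * S + x.length) * S + x.length)) =
    binomKernel j x x % n
  left_right : ∀ j < S, mem (3 * (S * S * S) + ((j * S + u.length) * S + x.length)) =
    binomKernel j u x % n

theorem Testing.wp_fillTables (h : Testing M S w x k u n σ) {s : Cmd Var} (hD : S * S * S ≤ D)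
    (hQ : ∀ τ, (∀ z ≠ .t, τ.var z = σ.var z) → Testing M S w x k u n τ →
      (∀ s < S * S * S, τ.mem s = σ.mem s) → Tables S u x n τ.mem → s.wp M D Q τ) :
    (fillTable .ua .ua .tab₁ ;; fillTable .xa .xa .tab₂ ;; fillTable .ua .xa .tab₃ ;; s).wp
      M D Q σ := by
  have hfill : ∀ {a b base : Var} {σ τ : St Var}, (fillTable a b base).Frame σ τ → ∀ z ≠ .t,
      τ.var z = σ.var z := fun hfr z hz => hfr z fun hmem => hz (List.mem_singleton.1 hmem)
  refine h.wp_fillTable h.located_ua h.located_ua (i := 1) (by decide) (by decide) (by decide)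
    (by rw [h.tab₁_eq, one_mul]) hD fun τ₁ hfr₁ h₁ out₁ entry₁ => ?_
  refine h₁.wp_fillTable h₁.located_xa h₁.located_xa (i := 2) (by decide) (by decide) (by decide)
    h₁.tab₂_eq hD fun τ₂ hfr₂ h₂ out₂ entry₂ => ?_
  refine h₂.wp_fillTable h₂.located_ua h₂.located_xa (i := 3) (by decide) (by decide) (by decide)
    h₂.tab₃_eq hD fun τ₃ hfr₃ h₃ out₃ entry₃ => ?_
  have hu := h.located_ua.length_lt
  have hx := h.located_xa.length_lt
  refine hQ τ₃ (fun z hz => ?_) h₃ (fun s hs => ?_) ⟨fun j hj => ?_, fun j hj => ?_, entry₃⟩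
  · rw [hfill hfr₃ z hz, hfill hfr₂ z hz, hfill hfr₁ z hz]
  · rw [out₃ s (by omega), out₂ s (by omega), out₁ s (by omega)]
  · have := tableIndex_lt hj hu hu
    rw [out₃ _ (by omega), out₂ _ (by omega), entry₁ j hj]
  · have := tableIndex_lt hj hx hx
    rw [out₃ _ (by omega), entry₂ j hj]

theorem Testing.identityMod_spec (h : Testing M S w x k u n σ) (hT : Tables S u x n σ.mem) {i : ℕ}
    (hi : i < S) (hj : σ.var .j = i) :
    identityMod.Ok M σ ∧ (identityMod.eval σ ≠ 0 ↔
      binomKernel i u u + binomKernel i x x ≡ 2 * binomKernel i u x [MOD n]) := by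
  have := h.length_le
  have hM := h.le_bound
  have hnine := h.nine_mul_size_le
  have hn := h.modulus_le
  have hu := h.located_ua.length_lt
  have hx := h.located_xa.length_lt
  have hpos : 0 < S := by omega
  have ht₁ : σ.var .tab₁ = 1 * (S * S * S) := by rw [h.tab₁_eq, one_mul]
  simp only [identityMod, Ex.Ok, Ex.eval, BinOp.Safe, BinOp.natEval, BinOp.eval, hj, ht₁,
    h.m_eq, h.size_eq, h.tab₂_eq, h.tab₃_eq, h.lx_eq, h.len_eq, hT.left_left i hi,
    hT.right_right i hi, hT.left_right i hi, true_and, and_true]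
  constructor
  · have i₁ := tableIndex_lt hi hu hu
    have i₂ := tableIndex_lt hi hx hx
    have i₃ := tableIndex_lt hi hu hx
    have l₁ := Nat.mod_lt (binomKernel i u u) h.modulus_pos
    have l₂ := Nat.mod_lt (binomKernel i x x) h.modulus_pos
    have l₃ := Nat.mod_lt (binomKernel i u x) h.modulus_pos
    have := Nat.le_mul_of_pos_right i hpos
    have hum := Nat.le_mul_of_pos_right (i * S + u.length) hpos
    have hxm := Nat.le_mul_of_pos_right (i * S + x.length) hpos
    (repeat' constructor) <;> omega
  · rw [← Nat.add_mod, Nat.mul_mod_mod]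
    simp [Nat.ModEq]

theorem Testing.wp_compareTables (h : Testing M S w x k u n σ) (hT : Tables S u x n σ.mem)
    (hD : S ≤ D) (hQ : ∀ τ, τ.mem = σ.mem →
      (τ.var .ok ≠ 0 ↔ σ.var .ok ≠ 0 ∧ ∀ j < σ.var .ord,
        binomKernel j u u + binomKernel j x x ≡ 2 * binomKernel j u x [MOD n]) → Q τ) :
    compareTables.wp M D Q σ := by
  have hord : σ.var .ord ≤ S := by have := h.length_le; rw [h.ord_eq]; omega
  refine Cmd.wp_loop (fun i τ => τ.mem = σ.mem ∧ (τ.var .ok ≠ 0 ↔ σ.var .ok ≠ 0 ∧ ∀ j < i,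
    binomKernel j u u + binomKernel j x x ≡ 2 * binomKernel j u x [MOD n]))
    (by decide) (by decide) (by decide) (hord.trans hD) ⟨rfl, by simp⟩ ?_ ?_
  · rintro i τ hi hfr ⟨hmem, hok⟩
    have hτ : Testing M S w x k u n (τ.set .j i) :=
      h.of_agree (fun z hz => hfr z (by revert hz; cases z <;> decide)) fun s _ => congrFun hmem s
    obtain ⟨hOk, heval⟩ := hτ.identityMod_spec (hmem ▸ hT) (hi.trans_le hord) (by simp)
    refine Cmd.wp_ite _ hOk heval (fun hi => ⟨hmem, ?_⟩) (fun hi => ⟨?_, hmem, ?_⟩)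
    · rw [Nat.forall_lt_succ_right, St.var_set, if_neg (by decide), hok]
      tauto
    · have := h.le_bound
      have := h.nine_mul_size_le
      have := h.length_le
      simp only [Ex.Ok]
      omega
    · rw [Nat.forall_lt_succ_right]
      simp [Ex.eval, hi]
  · rintro τ - ⟨hmem, hok⟩
    exact hQ _ hmem (by simpa using hok)

theorem Testing.wp_testModulus (h : Testing M S w x k u n σ) (hD : S * S * S ≤ D)
    (hQ : ∀ τ, (∀ s < S * S * S, τ.mem s = σ.mem s) →
      (τ.var .ok ≠ 0 ↔ σ.var .ok ≠ 0 ∧ ∀ j < σ.var .ord,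
        binomKernel j u u + binomKernel j x x ≡ 2 * binomKernel j u x [MOD n]) → Q τ) :
    testModulus.wp M D Q σ :=
  h.wp_fillTables hD fun υ hv hυ hmem hT =>
    hυ.wp_compareTables hT (by have := h.nine_mul_size_le; omega) fun τ hmemτ hok =>
      hQ τ (fun s hs => (congrFun hmemτ s).trans (hmem s hs))
        (by rwa [hv .ok (by decide), hv .ord (by decide)] at hok)

theorem wp_testFactor (h : Ready M S w x k σ) (hlen : σ.var .len = u.length)
    (hul : u.length ≤ w.length) (hua : σ.var .ua ≤ w.length + 1)
    (hu : wordAt σ.mem (σ.var .ua) u.length = u) (hD : S * S * S ≤ D)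
    (hQ : ∀ τ, testFactor.Frame σ τ → (∀ s < S * S * S, τ.mem s = σ.mem s) →
      (τ.var .ok ≠ 0 ↔ σ.var .ok ≠ 0 ∧ BinomEquiv k u x) → Q τ) :
    testFactor.wp M D Q σ := by
  have hS := h.length_le
  have hnine := h.nine_mul_size_le
  have hM := h.le_bound
  refine Cmd.wp_loop (fun i τ => (∀ s < S * S * S, τ.mem s = σ.mem s) ∧
      (τ.var .ok ≠ 0 ↔ σ.var .ok ≠ 0 ∧ ∀ n < i, ∀ j < σ.var .ord,
        binomKernel j u u + binomKernel j x x ≡ 2 * binomKernel j u x [MOD n + 1]))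
    (by decide) (by decide) (by decide) (by rw [h.mods_eq]; omega) ⟨fun _ _ => rfl, by simp⟩ ?_ ?_
  · rintro i τ hi hfr ⟨hmem, hok⟩
    rw [h.mods_eq] at hi
    refine ⟨⟨trivial, ?_, ?_⟩, ?_⟩
    · simp only [Ex.Ok]
      omega
    · simp only [Ex.eval, BinOp.Safe, St.var_set, if_true]
      omega
    have heval : (Var.r +ₑ .lit 1 : Ex Var).eval (τ.set .r i) = i + 1 := by
      simp [Ex.eval, BinOp.natEval, BinOp.eval]
    rw [heval]
    have hv : ∀ z ∉ testFactor.writes, ((τ.set .r i).set .m (i + 1)).var z = σ.var z :=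
      fun z hz => by rw [St.var_set, if_neg (by revert hz; cases z <;> decide), hfr z hz]
    have hTesting : Testing M S w x k u (i + 1) ((τ.set .r i).set .m (i + 1)) :=
      ⟨h.of_agree (fun z hz => hv z (by revert z; decide)) fun s hs => hmem s (by omega),
        i.succ_pos, hi, by simp, (hv .len (by decide)).trans hlen, hul,
        (hv .ua (by decide)).trans_le hua,
        hv .ua (by decide) ▸ (wordAt_congr fun s hs => hmem _ (by omega)).trans hu⟩
    refine hTesting.wp_testModulus hD fun ρ hmemρ hokρ =>
      ⟨fun s hs => (hmemρ s hs).trans (hmem s hs), ?_⟩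
    rw [hokρ, hv .ord (by decide), Nat.forall_lt_succ_right, ← and_assoc, ← hok]
    simp
  · rintro τ hfr ⟨hmem, hok⟩
    refine hQ _ hfr hmem ?_
    rw [binomEquiv_iff_forall_modEq (N := S) (by omega) (by omega)]
    rw [h.mods_eq, h.ord_eq] at hok
    rw [h.mods_eq, St.var_set, if_neg (by decide), hok]
    refine and_congr_right fun _ => ⟨fun hall j hj m hm hmS => ?_, fun hall n hn j hj =>
      hall j (Nat.le_of_lt_succ hj) _ n.succ_pos hn⟩
    exact Nat.sub_add_cancel hm ▸ hall (m - 1) (by omega) j (Nat.lt_succ_of_le hj)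

end TestFactor

/-! ### The search -/

theorem take_drop_wordAt {mem : ℕ → ℕ} {a i l n : ℕ} (h : i + l ≤ n) :
    ((wordAt mem a n).drop i).take l = wordAt mem (i + a) l := by
  refine List.ext_getElem (by simp; omega) fun j hj hj' => ?_
  simp [wordAt, add_comm, add_left_comm]

open Classical in
/-- The matches among the first `t` pairs, in the order in which the program tests the pairs. -/
noncomputable def matchesBefore (w x : List ℕ) (k t : ℕ) : List (ℕ × ℕ) :=
  ((List.range t).map fun q => (q / (w.length + 1), q % (w.length + 1))).filter
    fun q => IsBinomMatch w x k q

section MatchesBefore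

variable {w x : List ℕ} {k t : ℕ}

open Classical in
theorem matchesBefore_succ : matchesBefore w x k (t + 1) = matchesBefore w x k t ++
    if IsBinomMatch w x k (t / (w.length + 1), t % (w.length + 1)) then
      [(t / (w.length + 1), t % (w.length + 1))] else [] := by
  rw [matchesBefore, List.range_succ, List.map_append, List.filter_append, ← matchesBefore]
  split_ifs with h <;> simp [h]

theorem nodup_matchesBefore : (matchesBefore w x k t).Nodup := by
  refine ((List.nodup_range).map fun q q' h => ?_).filter _
  rw [← Nat.div_add_mod q (w.length + 1), ← Nat.div_add_mod q' (w.length + 1)]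
  simp_all only [Prod.mk.injEq]

theorem mem_matchesBefore {p : ℕ × ℕ} :
    p ∈ matchesBefore w x k ((w.length + 1) * (w.length + 1)) ↔ IsBinomMatch w x k p := by
  simp only [matchesBefore, List.mem_filter, List.mem_map, List.mem_range, decide_eq_true_eq]
  refine and_iff_right_of_imp fun ⟨hle, _⟩ => ⟨p.1 * (w.length + 1) + p.2, ?_, ?_⟩
  · nlinarith
  · obtain ⟨hdiv, hmod⟩ := mul_add_div_mod (d := p.1) (by omega : p.2 < w.length + 1)
    rw [hdiv, hmod]

theorem length_pairsOutput (L : List (ℕ × ℕ)) : (pairsOutput L).length = 2 * L.length := by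
  simp [pairsOutput, mul_comm]

theorem length_matchesBefore_le : (matchesBefore w x k t).length ≤ t :=
  (List.length_filter_le _ _).trans_eq (by simp)

end MatchesBefore

open Var in
/-- Append the pair `(pos, len)` to the output if `ok` is nonzero. -/
def record : Cmd Var :=
  .ite ok (.store (out +ₑ cnt) pos ;; .store (out +ₑ cnt +ₑ .lit 1) len ;;
    .assign cnt (cnt +ₑ .lit 2)) .skip

open Var in
/-- Find the start and the length of the factor for the pair with number `q`, and let `ok` be
nonzero if it lies inside the first word. -/
def locatePair : Cmd Var :=
  .assign pos (q /ₑ num) ;; .assign len (q %ₑ num) ;; .assign ua (pos +ₑ .lit 1) ;;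
    .assign ok (pos +ₑ len <ₑ num)

/-- Test the pair with number `q`, and append it to the output if it is a match. -/
def testPair : Cmd Var :=
  locatePair ;; testFactor ;; record

open Var in
/-- Append all matches to the output. -/
def search : Cmd Var :=
  .loop q pairs testPair

/-- The state `σ` is prepared for the search, and the matches among the first `t` pairs have been
found. -/
structure Searched (M S : ℕ) (w x : List ℕ) (k t : ℕ) (σ : St Var) : Prop
    extends Ready M S w x k σ where
  output_eq : wordAt σ.mem S (σ.var .cnt) = pairsOutput (matchesBefore w x k t)

section Search

variable {M D S k t : ℕ} {w x : List ℕ} {σ τ : St Var} {Q : St Var → Prop}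

theorem Searched.cnt_le (h : Searched M S w x k t σ)
    (ht : t ≤ (w.length + 1) * (w.length + 1)) : S + σ.var .cnt + 2 ≤ S * S * S := by
  have hS := h.length_le
  have hcnt : σ.var .cnt = 2 * (matchesBefore w x k t).length := by
    rw [← length_pairsOutput, ← h.output_eq, length_wordAt]
  have hlen := length_matchesBefore_le (w := w) (x := x) (k := k) (t := t)
  have hw : (w.length + 1) * (w.length + 1) ≤ S * S := Nat.mul_le_mul (by omega) (by omega)
  have hSS : S * 3 ≤ S * S := Nat.mul_le_mul_left _ (by omega)
  have hSSS : S * S * 3 ≤ S * S * S := Nat.mul_le_mul_left _ (by omega)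
  omega

theorem Searched.of_agree (h : Searched M S w x k t σ)
    (ht : t ≤ (w.length + 1) * (w.length + 1))
    (hvar : ∀ z ∈ [Var.cnt, .size, .vol, .tab₁, .tab₂, .tab₃, .lx, .xa, .num, .pairs, .ord, .mods,
      .out], τ.var z = σ.var z)
    (hmem : ∀ s < S * S * S, τ.mem s = σ.mem s) : Searched M S w x k t τ := by
  have hle := h.cnt_le ht
  refine ⟨h.toReady.of_agree (fun z hz => hvar z (List.mem_cons_of_mem _ hz)) fun s hs => hmem s
    (by omega), ?_⟩
  rw [hvar .cnt (by decide)]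
  exact (wordAt_congr fun i hi => hmem _ (by omega)).trans h.output_eq

theorem Searched.wp_record (h : Searched M S w x k t σ)
    (ht : t < (w.length + 1) * (w.length + 1)) (hpos : σ.var .pos = t / (w.length + 1))
    (hlen : σ.var .len = t % (w.length + 1))
    (hok : σ.var .ok ≠ 0 ↔ IsBinomMatch w x k (t / (w.length + 1), t % (w.length + 1))) :
    record.wp M D (Searched M S w x k (t + 1)) σ := by
  have hM := h.le_bound
  have hle := h.cnt_le ht.le
  have := h.length_le
  refine Cmd.wp_ite _ trivial hok (fun hmatch => ?_) fun hmatch => ⟨h.toReady, ?_⟩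
  · simp only [Cmd.wp, Ex.Ok, Ex.eval, BinOp.Safe, BinOp.natEval, BinOp.eval, St.var_write,
      h.out_eq, true_and]
    refine ⟨by omega, by omega, by omega, h.toReady.of_agree ?_ ?_, ?_⟩
    · simp
    · intro s hs
      simp only [St.mem_set, St.mem_write]
      rw [if_neg (by omega), if_neg (by omega)]
    · simp only [St.mem_set, St.var_set, if_true]
      rw [wordAt_succ, wordAt_succ, matchesBefore_succ, if_pos hmatch, ← hpos, ← hlen,
        wordAt_congr (mem' := σ.mem) fun i hi => ?_, h.output_eq]
      · simp [pairsOutput, St.mem_write, ← add_assoc]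
      · rw [St.mem_write, St.mem_write, if_neg (by omega), if_neg (by omega)]
  · rw [matchesBefore_succ, if_neg hmatch, List.append_nil, h.output_eq]

theorem Searched.wp_locatePair (h : Searched M S w x k t σ) (hq : σ.var .q = t)
    (ht : t < (w.length + 1) * (w.length + 1))
    (hQ : ∀ τ, Searched M S w x k t τ → τ.var .pos = t / (w.length + 1) →
      τ.var .len = t % (w.length + 1) → τ.var .ua = t / (w.length + 1) + 1 →
      (τ.var .ok ≠ 0 ↔ t / (w.length + 1) + t % (w.length + 1) ≤ w.length) → Q τ) :
    locatePair.wp M D Q σ := by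
  have hM := h.le_bound
  have hS := h.length_le
  have hnine := h.nine_mul_size_le
  have hdiv : t / (w.length + 1) ≤ w.length := Nat.le_of_lt_succ (Nat.div_lt_of_lt_mul ht)
  have hmod : t % (w.length + 1) ≤ w.length := Nat.le_of_lt_succ (Nat.mod_lt _ w.length.succ_pos)
  simp only [locatePair, Cmd.wp, Ex.Ok, Ex.eval, BinOp.Safe, BinOp.natEval, BinOp.eval, St.var_set,
    reduceCtorEq, if_true, if_false, hq, h.num_eq, true_and, and_true]
  refine ⟨by omega, by omega, hQ _ (h.of_agree ht.le ?_ fun _ _ => rfl) ?_ ?_ ?_ ?_⟩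
  all_goals simp

theorem Searched.wp_testPair (h : Searched M S w x k t σ) (hq : σ.var .q = t)
    (ht : t < (w.length + 1) * (w.length + 1)) (hD : S * S * S ≤ D) :
    testPair.wp M D (Searched M S w x k (t + 1)) σ := by
  have hdiv : t / (w.length + 1) ≤ w.length := Nat.le_of_lt_succ (Nat.div_lt_of_lt_mul ht)
  have hmod : t % (w.length + 1) ≤ w.length := Nat.le_of_lt_succ (Nat.mod_lt _ w.length.succ_pos)
  refine h.wp_locatePair hq ht fun τ hτ hpos hlen hua hok => ?_
  set u := wordAt τ.mem (τ.var .ua) (τ.var .len) with hu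
  have hul : u.length = τ.var .len := length_wordAt ..
  refine wp_testFactor hτ.toReady hul.symm (hul.trans_le (hlen.trans_le hmod)) (by omega)
    (by rw [hul]) hD fun υ hfr hmem hokυ => ?_
  refine (hτ.of_agree ht.le (fun z hz => hfr z (by revert z; decide)) hmem).wp_record ht
    ((hfr .pos (by decide)).trans hpos) ((hfr .len (by decide)).trans hlen) ?_
  rw [hokυ, hok]
  refine and_congr_right fun hle => ?_
  have hfactor : (w.drop (t / (w.length + 1))).take (t % (w.length + 1)) = u := by
    rw [hu, hua, hlen, ← take_drop_wordAt hle, hτ.left_eq]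
  rw [hfactor]

theorem wp_search (h : Ready M S w x k σ) (hcnt : σ.var .cnt = 0) (hD : S * S * S ≤ D)
    (hQ : ∀ τ, Searched M S w x k ((w.length + 1) * (w.length + 1)) τ → Q τ) :
    search.wp M D Q σ := by
  have hle : (w.length + 1) * (w.length + 1) ≤ D := by
    have hS := h.length_le
    exact (Nat.mul_le_mul (by omega) (by omega)).trans
      ((Nat.le_mul_of_pos_right (S * S) (by omega)).trans hD)
  refine Cmd.wp_loop (Searched M S w x k) (by decide) (by decide) (by decide)
    (h.pairs_eq.trans_le hle) ⟨h, ?_⟩ (fun t τ ht hfr hτ => ?_) fun τ _ hτ => hQ _ ?_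
  · rw [hcnt]
    rfl
  · rw [h.pairs_eq] at ht
    have hset : Searched M S w x k t (τ.set .q t) := hτ.of_agree ht.le (by simp) fun _ _ => rfl
    exact hset.wp_testPair (by simp) ht hD
  · rw [h.pairs_eq] at hτ ⊢
    exact ⟨hτ.toReady.of_agree (by simp) fun _ _ => rfl, hτ.output_eq⟩

end Search

/-! ### Reading the input -/

/-- The words `w`, `x` and `ds` stand in the memory, each preceded by its length. -/
structure InputAt (w x ds : List ℕ) (mem : ℕ → ℕ) : Prop where
  left_length : mem 0 = w.length
  left_eq : wordAt mem 1 w.length = w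
  right_length : mem (w.length + 1) = x.length
  right_eq : wordAt mem (w.length + 2) x.length = x
  digits_length : mem (w.length + x.length + 2) = ds.length
  digits_eq : wordAt mem (w.length + x.length + 3) ds.length = ds

theorem wordAt_getD {input l₁ l l₂ : List ℕ} (h : input = l₁ ++ (l ++ l₂)) {a : ℕ}
    (ha : a = l₁.length) : wordAt (fun i => input.getD i 0) a l.length = l := by
  subst h ha
  refine List.ext_getElem (by simp) fun i _ hi => ?_
  simp [wordAt, List.getElem?_append_right, List.getElem?_append_left hi, hi]

theorem getD_append_cons {input l₁ l₂ : List ℕ} {b : ℕ} (h : input = l₁ ++ b :: l₂) {a : ℕ}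
    (ha : a = l₁.length) : input.getD a 0 = b := by
  simp [h, ha]

theorem inputAt_matchInput {A : Type} (code : A → ℕ) (w x : List A) (k : ℕ) :
    InputAt (w.map code) (x.map code) (Nat.digits 2 k)
      fun i => (matchInput code w x k).getD i 0 where
  left_length := by simp [matchInput]
  left_eq := wordAt_getD (l₁ := [w.length]) (l₂ := x.length :: x.map code ++
    (Nat.digits 2 k).length :: Nat.digits 2 k) (by simp [matchInput]) rfl
  right_length := getD_append_cons (l₁ := w.length :: w.map code) (l₂ := x.map code ++
    (Nat.digits 2 k).length :: Nat.digits 2 k) (by simp [matchInput]) (by simp)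
  right_eq := wordAt_getD (l₁ := w.length :: w.map code ++ [x.length])
    (l₂ := (Nat.digits 2 k).length :: Nat.digits 2 k) (by simp [matchInput]) (by simp)
  digits_length := getD_append_cons (l₁ := w.length :: w.map code ++ x.length :: x.map code)
    (l₂ := Nat.digits 2 k) (by simp [matchInput]) (by simp; omega)
  digits_eq := wordAt_getD (l₂ := [])
    (l₁ := w.length :: w.map code ++ x.length :: x.map code ++ [(Nat.digits 2 k).length])
    (by simp [matchInput]) (by simp; omega)

theorem length_matchInput {A : Type} (code : A → ℕ) (w x : List A) (k : ℕ) :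
    (matchInput code w x k).length =
      w.length + x.length + (Nat.digits 2 k).length + 3 := by
  simp only [matchInput, List.length_append, List.length_cons, List.length_map]
  omega

theorem lt_of_mem_matchInput {A : Type} {code : A → ℕ} {w x : List A} {k M : ℕ}
    (hcode : ∀ a, code a < M) (hM : (matchInput code w x k).length ≤ M) :
    ∀ a ∈ matchInput code w x k, a < M := by
  have hlen := length_matchInput code w x k
  simp only [matchInput, List.mem_append, List.mem_cons, List.mem_map]
  rintro a (((rfl | ⟨b, -, rfl⟩) | (rfl | ⟨b, -, rfl⟩)) | (rfl | hd))
  · omega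
  · exact hcode b
  · omega
  · exact hcode b
  · omega
  · have := Nat.digits_lt_base one_lt_two hd
    omega

open Var in
/-- Read the lengths of the three parts of the input, and compute its size. -/
def readLengths : Cmd Var :=
  .assign num (.load (.lit 0) +ₑ .lit 1) ;; .assign lx (.load num) ;;
    .assign nd (.load (num +ₑ lx +ₑ .lit 1)) ;; .assign size (num +ₑ lx +ₑ nd +ₑ .lit 2) ;;
    .assign cap (size -ₑ .lit 1)

open Var in
/-- Add to `ord` the number with the given binary digits by Horner's rule, but let `ord` not exceed
`cap`, since the number need not fit into a machine word. -/
def readOrder : Cmd Var :=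
  .loop i nd (.assign ord (.lit 2 *ₑ ord +ₑ .load (cap -ₑ i)) ;;
    .ite (cap <ₑ ord) (.assign ord cap) .skip)

open Var in
/-- Compute the constants of the search. -/
def prepare : Cmd Var :=
  .assign ord (ord +ₑ .lit 1) ;; .assign pairs (num *ₑ num) ;;
    .assign vol (size *ₑ size *ₑ size) ;; .assign tab₁ vol ;; .assign tab₂ (.lit 2 *ₑ vol) ;;
    .assign tab₃ (.lit 3 *ₑ vol) ;; .assign mods (.lit 4 *ₑ size) ;; .assign xa (num +ₑ .lit 1) ;;
    .assign out size

/-- The matching program. -/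
def matchProgram : Cmd Var :=
  readLengths ;; readOrder ;; prepare ;; search

/-- The input stands in the memory of `σ`, and its lengths have been read. -/
structure Measured (w x ds : List ℕ) (σ : St Var) : Prop extends InputAt w x ds σ.mem where
  num_eq : σ.var .num = w.length + 1
  lx_eq : σ.var .lx = x.length
  nd_eq : σ.var .nd = ds.length
  size_eq : σ.var .size = w.length + x.length + ds.length + 3
  cap_eq : σ.var .cap = w.length + x.length + ds.length + 2

section Read

variable {M D k : ℕ} {w x ds : List ℕ} {σ : St Var} {Q : St Var → Prop}

theorem InputAt.wp_readLengths (h : InputAt w x ds σ.mem)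
    (hM : w.length + x.length + ds.length + 3 < M)
    (hQ : ∀ τ, readLengths.Frame σ τ → Measured w x ds τ → Q τ) : readLengths.wp M D Q σ := by
  have hadd : w.length + 1 + x.length + 1 = w.length + x.length + 2 := by omega
  simp only [readLengths, Cmd.wp, Ex.Ok, Ex.eval, BinOp.Safe, BinOp.natEval, BinOp.eval,
    St.var_set, St.mem_set, reduceCtorEq, if_true, if_false, true_and, h.left_length,
    h.right_length, hadd, h.digits_length]
  refine ⟨by omega, by omega, by omega, by omega, hQ _ (fun z hz => ?_) ⟨h, ?_, ?_, ?_, ?_, ?_⟩⟩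
  · revert hz
    cases z <;> simp [readLengths, Cmd.writes]
  all_goals simp
  all_goals omega

theorem ofDigits_drop_length_sub_succ {b j : ℕ} (hj : j < ds.length) :
    Nat.ofDigits b (ds.drop (ds.length - (j + 1))) =
      ds[ds.length - (j + 1)] + b * Nat.ofDigits b (ds.drop (ds.length - j)) := by
  rw [List.drop_eq_getElem_cons (by omega), Nat.ofDigits_cons,
    show ds.length - (j + 1) + 1 = ds.length - j by omega]

theorem Measured.wp_readOrder (h : Measured w x ds σ) (hds : ∀ d ∈ ds, d < 2)
    (hord : σ.var .ord = 0) (hM : 2 * (w.length + x.length + ds.length + 3) ≤ M)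
    (hD : ds.length ≤ D)
    (hQ : ∀ τ, readOrder.Frame σ τ → τ.mem = σ.mem → τ.var .ord =
      min (Nat.ofDigits 2 ds) (w.length + x.length + ds.length + 2) → Q τ) :
    readOrder.wp M D Q σ := by
  refine Cmd.wp_loop (fun j τ => τ.mem = σ.mem ∧ τ.var .ord =
    min (Nat.ofDigits 2 (ds.drop (ds.length - j))) (w.length + x.length + ds.length + 2))
    (by decide) (by decide) (by decide) (h.nd_eq.trans_le hD) ⟨rfl, by simp [hord]⟩ ?_ ?_
  · rintro j τ hj hfr ⟨hmem, hτ⟩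
    rw [h.nd_eq] at hj
    have hcap : τ.var .cap = w.length + x.length + ds.length + 2 :=
      (hfr .cap (by decide)).trans h.cap_eq
    have hlt : ds.length - (j + 1) < ds.length := by omega
    have hbit := hds _ (List.getElem_mem hlt)
    have hload : τ.mem (w.length + x.length + ds.length + 2 - j) = ds[ds.length - (j + 1)] := by
      rw [List.getElem_of_eq h.digits_eq.symm hlt, hmem]
      simp only [wordAt, List.getElem_map, List.getElem_range]
      congr 1
      omega
    simp only [Cmd.wp, Ex.Ok, Ex.eval, BinOp.Safe, BinOp.natEval, BinOp.eval, St.var_set,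
      St.mem_set, reduceCtorEq, if_true, if_false, true_and, and_true, hcap, hload, hmem,
      ofDigits_drop_length_sub_succ hj, ne_eq, ite_eq_right_iff, one_ne_zero, imp_false, not_not]
    exact ⟨by omega, fun hgt => by omega, fun hle => by omega⟩
  · rintro τ hfr ⟨hmem, hτ⟩
    refine hQ _ hfr hmem ?_
    rw [h.nd_eq, Nat.sub_self, List.drop_zero] at hτ
    simpa using hτ

theorem Measured.wp_prepare {S : ℕ} (h : Measured w x ds σ)
    (hS : w.length + x.length + ds.length + 3 = S) (hM : 4 * (S * S * S) ≤ M)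
    (hord : σ.var .ord = min k (S - 1))
    (hQ : ∀ τ, Ready M S w x k τ → τ.var .cnt = σ.var .cnt → Q τ) : prepare.wp M D Q σ := by
  have hnine : 9 * S ≤ S * S * S := nine_mul_le_cube (by omega)
  have hsq : S * S ≤ S * S * S := Nat.le_mul_of_pos_right _ (by omega)
  have hpairs : (w.length + 1) * (w.length + 1) ≤ S * S := Nat.mul_le_mul (by omega) (by omega)
  have hsize := h.size_eq.trans hS
  simp only [prepare, Cmd.wp, Ex.Ok, Ex.eval, BinOp.Safe, BinOp.natEval, BinOp.eval, St.var_set,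
    reduceCtorEq, if_true, if_false, true_and, hsize, h.num_eq, hord]
  refine ⟨by omega, by omega, by omega, by omega, by omega, by omega, by omega,
    hQ _ ?_ (by simp)⟩
  constructor
  case length_le => omega
  case le_bound => exact hM
  case left_eq => exact h.left_eq
  case right_eq => exact h.right_eq
  all_goals simp [hsize, h.lx_eq, h.num_eq]

theorem InputAt.wp_matchProgram {S : ℕ} (h : InputAt w x (Nat.digits 2 k) σ.mem)
    (hord : σ.var .ord = 0) (hcnt : σ.var .cnt = 0)
    (hS : w.length + x.length + (Nat.digits 2 k).length + 3 = S) (hM : 4 * (S * S * S) ≤ M)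
    (hD : S * S * S ≤ D)
    (hQ : ∀ τ, Searched M S w x k ((w.length + 1) * (w.length + 1)) τ → Q τ) :
    matchProgram.wp M D Q σ := by
  have hnine : 9 * S ≤ S * S * S := nine_mul_le_cube (by omega)
  refine h.wp_readLengths (by omega) fun τ₁ hfr₁ h₁ => ?_
  refine h₁.wp_readOrder (fun d hd => Nat.digits_lt_base one_lt_two hd)
    ((hfr₁ .ord (by decide)).trans hord) (by omega) (by omega) fun τ₂ hfr₂ hmem₂ hord₂ => ?_
  have h₂ : Measured w x (Nat.digits 2 k) τ₂ :=
    ⟨hmem₂ ▸ h₁.toInputAt, (hfr₂ .num (by decide)).trans h₁.num_eq,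
      (hfr₂ .lx (by decide)).trans h₁.lx_eq, (hfr₂ .nd (by decide)).trans h₁.nd_eq,
      (hfr₂ .size (by decide)).trans h₁.size_eq, (hfr₂ .cap (by decide)).trans h₁.cap_eq⟩
  rw [Nat.ofDigits_digits] at hord₂
  refine h₂.wp_prepare (k := k) hS hM (by rw [hord₂]; omega) fun τ₃ h₃ hcnt₃ => ?_
  refine wp_search h₃ ?_ hD hQ
  rw [hcnt₃, hfr₂ .cnt (by decide), hfr₁ .cnt (by decide), hcnt]

end Read

theorem Searched.outputs {M S k : ℕ} {w x : List ℕ} {σ : St Var}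
    (h : Searched M S w x k ((w.length + 1) * (w.length + 1)) σ) {L : List ℕ}
    (hL : pairsOutput (matchesBefore w x k ((w.length + 1) * (w.length + 1))) = L) :
    σ.var .cnt = L.length ∧ σ.var .out + L.length ≤ M ∧
      ∀ (i : ℕ) (hi : i < L.length), σ.mem (σ.var .out + i) = L[i] := by
  obtain rfl := h.output_eq.trans hL
  have hle := h.cnt_le le_rfl
  have hM := h.le_bound
  rw [h.out_eq]
  exact ⟨(length_wordAt ..).symm, by rw [length_wordAt]; omega, fun i hi => by simp [wordAt]⟩

theorem computesWithin_matchProgram {W S k : ℕ} {w x input : List ℕ} (hW : 0 < W)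
    (h : InputAt w x (Nat.digits 2 k) fun i => input.getD i 0)
    (hS : w.length + x.length + (Nat.digits 2 k).length + 3 = S)
    (hinput : ∀ a ∈ input, a < 2 ^ W) (hM : 4 * (S * S * S) ≤ 2 ^ W) :
    ComputesWithin W (matchProgram.compile Var.register 0) input
      ((matchProgram.time Var.register).eval (S * S * S))
      (pairsOutput (matchesBefore w x k ((w.length + 1) * (w.length + 1)))) :=
  Cmd.computesWithin_compile hW (start := .out) (size := .cnt) rfl rfl hinput
    (InputAt.wp_matchProgram h rfl rfl hS hM le_rfl fun _ hτ => hτ.outputs rfl)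

end WordRAM

/-- Pattern matching under `k`-binomial equivalence in polynomial time: one program, one
polynomial `p` and one constant `C` serve all alphabets, all words `w` and `x`, all numbers `k`, and
all word sizes `W ≥ C * log₂ N`, where `N` is the size of the input. The letters of the alphabet are
given as distinct machine words. -/
theorem theorem3 :
    ∃ (P : WordRAM.Program) (p : Polynomial ℕ) (C : ℕ), 0 < C ∧
      ∀ (A : Type) [DecidableEq A] (W : ℕ) (code : A → ℕ),
        Function.Injective code → (∀ a, code a < 2 ^ W) →
        ∀ (w x : List A) (k : ℕ),
          (matchInput code w x k).length ^ C ≤ 2 ^ W →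
          ∃ L : List (ℕ × ℕ),
            L.Nodup ∧ (∀ q, q ∈ L ↔ IsBinomMatch w x k q) ∧
            WordRAM.ComputesWithin W P (matchInput code w x k)
              (p.eval (matchInput code w x k).length) (pairsOutput L) := by
  refine ⟨WordRAM.matchProgram.compile WordRAM.Var.register 0,
    (WordRAM.matchProgram.time WordRAM.Var.register).comp (.X * .X * .X), 5, by norm_num, ?_⟩
  intro A _ W code hcode hlt w x k hW
  have hlen := WordRAM.length_matchInput code w x k
  set N := (matchInput code w x k).length
  have hN : 3 ≤ N := by omega
  have hcube : 4 * (N * N * N) ≤ 2 ^ W := by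
    refine le_trans ?_ hW
    calc 4 * (N * N * N) ≤ N * N * (N * N * N) := Nat.mul_le_mul_right _ (by nlinarith)
      _ = N ^ 5 := by ring
  have hself : N ≤ 2 ^ W := (Nat.le_self_pow (by norm_num) N).trans hW
  have hpos : 0 < W := Nat.pos_of_ne_zero fun h => by
    rw [h, pow_zero] at hself
    omega
  refine ⟨_, WordRAM.nodup_matchesBefore,
    fun q => WordRAM.mem_matchesBefore.trans (isBinomMatch_map hcode w x k q), ?_⟩
  simpa using WordRAM.computesWithin_matchProgram hpos (WordRAM.inputAt_matchInput code w x k)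
    (by simpa using hlen.symm) (WordRAM.lt_of_mem_matchInput hlt hself) hcube
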